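/- **Setting.** Write $\langle F\rangle=\frac1{2\pi}\int_{-\pi}^{\pi}F(\lambda)\,d\lambda$. A spectral density is an integrable function on $[-\pi,\pi)$ that is nonnegative almost everywhere; pointwise relations between functions of $\lambda$ below are understood almost everywhere. Let $(a(k))_{k\ge 0}$ be complex numbers with $\sum|a(k)|<\infty$ and $\sum(k+1)|a(k)|^2<\infty$, and put $A(e^{i\lambda})=\sum_{k\ge0}a(k)e^{-ik\lambda}$. Let $\xi,\eta$ be uncorrelated zero-mean stationary sequences with spectral densities $f,g$, i.e. $E\,\xi(m)\overline{\xi(n)}=\langle e^{i(m-n)\lambda}f\rangle$, $E\,\eta(m)\overline{\eta(n)}=\langle e^{i(m-n)\lambda}g\rangle$, $E\,\xi(m)\overline{\eta(n)}=0$. The functional $A\xi=\sum_{k\ge 0}a(k)\xi(-k)$ is estimated from the observations $\xi(m)+\eta(m)$, $m\le 0$, by elements of their closed linear span $H^0(\xi+\eta)$ in $L^2(\Omega)$. Let $L_2^0(f+g)$ be the closed span of $e^{im\lambda}$, $m\le0$, in $L_2(f+g)$. The estimate $\int h\,dZ_{\xi+\eta}$ with spectral characteristic $h\in L_2^0(f+g)$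 has mean-square error $$\Delta(h;f,g)=\langle |A-h|^2f\rangle+\langle|h|^2g\rangle .$$ The optimal characteristic $h(f,g)$ minimises $\Delta(\cdot\,;f,g)$ over $L_2^0(f+g)$; put $\Delta(f,g)=\Delta(h(f,g);f,g)$. **Operators.** The pair $(f,g)$ satisfies the minimality condition if $\int_{-\pi}^{\pi}(f+g)^{-1}d\lambda<\infty$. In that case let, for $k,j\ge0$, $$P_{k,j}=\Big\langle \frac{e^{i\lambda(j-k)}}{f+g}\Big\rangle,\quad R_{k,j}=\Big\langle e^{-i\lambda(j+k)}\frac{f}{f+g}\Big\rangle,\quad Q_{k,j}=\Big\langle e^{i\lambda(k-j)}\frac{fg}{f+g}\Big\rangle,$$ let $\mathbf P,\mathbf Q$ be the operators with matrices $(P_{l,k})_{l,k\ge0}$, $(Q_{l,k})_{l,k\ge0}$, and let $(\mathbf R\mathbf a)_l=\sum_{m\ge0}R_{l+1,m}a(m)$, $l\ge0$. The operator $\mathbf P$ may be unbounded and is taken on its form domain: $c=\mathbf P^{-1}\mathbf R\mathbf a$ means that $c=(c(k))_{k\ge0}$ is the sequence of coefficients of an integrable function with Fourier series $C(e^{i\lambda})=\sum_{k\ge0}c(k)e^{i\lambda(k+1)}$,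 that $\langle|C|^2/(f+g)\rangle<\infty$, and that $(\mathbf Pc)_l:=\langle e^{-i\lambda(l+1)}C/(f+g)\rangle=(\mathbf R\mathbf a)_l$ for all $l\ge0$ (for finitely supported $c$ this $\mathbf Pc$ is the matrix product). The inner product $\langle\mathbf R\mathbf a,\mathbf P^{-1}\mathbf R\mathbf a\rangle=\sum_{l}(\mathbf R\mathbf a)_l\overline{c(l)}$ is summed by arithmetic means of partial sums, which is the $\ell_2$ inner product when $c\in\ell_2$. Put $$h_f=\frac{|A g+C|}{f+g},\qquad h_g=\frac{|A f-C|}{f+g}.$$ **Classes.** Let $u,v,g_1$ be given spectral densities, $u,v$ bounded, $0\le\varepsilon\le1$, $P_1,P_2\in\mathbb R$, and $$\mathcal D^u_v=\{f: v\le f\le u,\ \langle f\rangle\le P_1\},\qquad \mathcal D_\varepsilon=\{g: g=(1-\varepsilon)g_1+\varepsilon w \text{ for some spectral density } w,\ \langle g\rangle\le P_2\},$$ $\mathcal D=\mathcal D^u_v\times\mathcal D_\varepsilon$, and $H_{\mathcal D}=\bigcap_{(f,g)\in\mathcal D}L_2^0(f+g)$. **Theorem.** Let $f^0\in\mathcal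 D^u_v$ and $g^0\in\mathcal D_\varepsilon$ satisfy the minimality condition, let $c^0=(\mathbf P^0)^{-1}\mathbf R^0\mathbf a$ and $C^0(e^{i\lambda})=\sum_{k\ge0}c^0(k)e^{i\lambda(k+1)}$ be formed from $(f^0,g^0)$, and suppose that $h_f(f^0,g^0)$ and $h_g(f^0,g^0)$ are bounded. Suppose that $$|A g^0+C^0|=(f^0+g^0)(\gamma_1+\gamma_2+\alpha_1^{-1}),\qquad |A f^0-C^0|=(f^0+g^0)(\varphi+\alpha_2^{-1})$$ for some nonzero real constants $\alpha_1,\alpha_2$ and some real functions $\gamma_1\le0$ with $\gamma_1=0$ where $f^0>v$; $\gamma_2\ge0$ with $\gamma_2=0$ where $f^0<u$; $\varphi\le0$ with $\varphi=0$ where $g^0>(1-\varepsilon)g_1$. Suppose finally that $(f^0,g^0)$ solves the optimization problem $$\langle\mathbf R\mathbf a,\mathbf P^{-1}\mathbf R\mathbf a\rangle+\langle\mathbf Q\mathbf a,\mathbf a\rangle\ \to\ \max$$ over the pairs $(f,g)\in\mathcal D$ that satisfy the minimality condition. Then: 1. $(f^0,g^0)$ is least favorable in $\mathcal D$: $\Delta(f^0,g^0)=\max_{(f,g)\in\mathcal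 D}\Delta(f,g)$; 2. the function $$h^0=h(f^0,g^0)=A\,\frac{f^0}{f^0+g^0}-\frac{C^0}{f^0+g^0}$$ is the optimal spectral characteristic for $(f^0,g^0)$, and it is minimax-robust: $h^0\in H_{\mathcal D}$ and $$\sup_{(f,g)\in\mathcal D}\Delta(h^0;f,g)=\min_{h\in H_{\mathcal D}}\ \sup_{(f,g)\in\mathcal D}\Delta(h;f,g).$$ Here, for every $(f,g)\in\mathcal D$ and all uncorrelated zero-mean stationary $\xi,\eta$ with spectral densities $f,g$, $\Delta(f,g)$ is the minimum of $E|A\xi-Y|^2$ over $Y\in H^0(\xi+\eta)$, and the estimate in $H^0(\xi+\eta)$ with spectral characteristic $h^0$ exists and has mean-square error $\Delta(h^0;f,g)$. -/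

import Mathlib

open MeasureTheory Filter Topology
open scoped ENNReal ComplexConjugate

noncomputable section

namespace RobustFilter

/-! ### Spectral densities and Fourier coefficients -/

/-- The normalised Lebesgue measure `dλ / 2π` on `[-π, π)`. -/
def circ : Measure ℝ :=
  ENNReal.ofReal (1 / (2 * Real.pi)) • volume.restrict (Set.Ico (-Real.pi) Real.pi)

/-- The exponential `e^{inλ}`. -/
def expo (n : ℤ) (x : ℝ) : ℂ := Complex.exp (Complex.I * ((n : ℂ) * (x : ℂ)))

/-- The Fourier coefficient `(1/2π) ∫ F(λ) e^{-inλ} dλ`. -/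
def coeff (F : ℝ → ℂ) (n : ℤ) : ℂ := ∫ x, expo (-n) x * F x ∂circ

/-- A spectral density: an integrable nonnegative function on `[-π, π)`. -/
def IsSpectralDensity (f : ℝ → ℝ) : Prop := Integrable f circ ∧ ∀ᵐ x ∂circ, 0 ≤ f x

/-- The spectral measure `s(λ) dλ / 2π`; `L₂(s)` is the `L²` space of this measure. -/
def spec (s : ℝ → ℝ) : Measure ℝ := circ.withDensity (fun x => ENNReal.ofReal (s x))

/-- The minimality condition `∫ (f + g)⁻¹ dλ < ∞`. Positivity a.e. is stated because `1 / 0 = 0` in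
Lean. -/
def Minimality (f g : ℝ → ℝ) : Prop :=
  (∀ᵐ x ∂circ, 0 < f x + g x) ∧ Integrable (fun x => 1 / (f x + g x)) circ

/-! ### The functional, the mean-square error, optimal characteristics -/

/-- `A(e^{iλ}) = ∑_{k ≥ 0} a(k) e^{-ikλ}`. -/
def symbolA (a : ℕ → ℂ) (x : ℝ) : ℂ := ∑' k : ℕ, a k * expo (-(k : ℤ)) x

/-- The trigonometric polynomial `∑_{k ≥ 0} b(k) e^{-ikλ}`. -/
def pastPoly (b : ℕ →₀ ℂ) (x : ℝ) : ℂ := ∑ k ∈ b.support, b k * expo (-(k : ℤ)) x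

/-- `h ∈ L₂⁰(s)`: `h` lies in the closed span in `L₂(s)` of the functions `e^{imλ}`, `m ≤ 0`. -/
def MemPast (s : ℝ → ℝ) (h : ℝ → ℂ) : Prop :=
  MemLp h 2 (spec s) ∧
    ∀ δ : ℝ≥0∞, 0 < δ → ∃ b : ℕ →₀ ℂ, eLpNorm (fun x => h x - pastPoly b x) 2 (spec s) < δ

/-- The mean-square error `Δ(h; f, g) = (1/2π) ∫ |A - h|² f dλ + (1/2π) ∫ |h|² g dλ` of the
estimate with spectral characteristic `h`. -/
def mse (a : ℕ → ℂ) (h : ℝ → ℂ) (f g : ℝ → ℝ) : ℝ≥0∞ :=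
  (∫⁻ x, ‖symbolA a x - h x‖ₑ ^ 2 ∂(spec f)) + ∫⁻ x, ‖h x‖ₑ ^ 2 ∂(spec g)

/-- The value `Δ(f, g) = Δ(h(f,g); f, g)` of the error of the optimal linear estimate. -/
def optErr (a : ℕ → ℂ) (f g : ℝ → ℝ) : ℝ≥0∞ :=
  ⨅ (h : ℝ → ℂ) (_ : MemPast (fun x => f x + g x) h), mse a h f g

/-- `h` is the spectral characteristic `h(f,g)` of the optimal linear estimate. -/
def IsOptimalChar (a : ℕ → ℂ) (f g : ℝ → ℝ) (h : ℝ → ℂ) : Prop :=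
  MemPast (fun x => f x + g x) h ∧ mse a h f g = optErr a f g

/-- `(f0, g0)` is least favorable in the class `D`. -/
def LeastFavorable (a : ℕ → ℂ) (D : Set ((ℝ → ℝ) × (ℝ → ℝ))) (f0 g0 : ℝ → ℝ) : Prop :=
  (f0, g0) ∈ D ∧
    IsGreatest ((fun q : (ℝ → ℝ) × (ℝ → ℝ) => optErr a q.1 q.2) '' D) (optErr a f0 g0)

/-- `H_D`, the intersection of the spaces `L₂⁰(f + g)` over `(f, g) ∈ D`. -/
def robustSpace (D : Set ((ℝ → ℝ) × (ℝ → ℝ))) : Set (ℝ → ℂ) :=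
  {h | ∀ q ∈ D, MemPast (fun x => q.1 x + q.2 x) h}

/-- The worst-case error `sup_{(f,g) ∈ D} Δ(h; f, g)`. -/
def worstErr (a : ℕ → ℂ) (D : Set ((ℝ → ℝ) × (ℝ → ℝ))) (h : ℝ → ℂ) : ℝ≥0∞ :=
  ⨆ q ∈ D, mse a h q.1 q.2

/-- `h0` is minimax-robust: `h0 ∈ H_D` and `h0` minimises the worst-case error over `H_D`. -/
def MinimaxRobust (a : ℕ → ℂ) (D : Set ((ℝ → ℝ) × (ℝ → ℝ))) (h0 : ℝ → ℂ) : Prop :=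
  h0 ∈ robustSpace D ∧ IsLeast (worstErr a D '' robustSpace D) (worstErr a D h0)

/-! ### The operators `P`, `R`, `Q` -/

/-- `P_{k,j} = (1/2π) ∫ e^{iλ(j-k)} / (f + g) dλ`. -/
def matP (f g : ℝ → ℝ) (k j : ℕ) : ℂ :=
  ∫ x, expo ((j : ℤ) - k) x * ((1 / (f x + g x) : ℝ) : ℂ) ∂circ

/-- `R_{k,j} = (1/2π) ∫ e^{-iλ(j+k)} f / (f + g) dλ`. -/
def matR (f g : ℝ → ℝ) (k j : ℕ) : ℂ :=
  ∫ x, expo (-((j : ℤ) + k)) x * ((f x / (f x + g x) : ℝ) : ℂ) ∂circ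

/-- `Q_{k,j} = (1/2π) ∫ e^{iλ(k-j)} f g / (f + g) dλ`. -/
def matQ (f g : ℝ → ℝ) (k j : ℕ) : ℂ :=
  ∫ x, expo ((k : ℤ) - j) x * ((f x * g x / (f x + g x) : ℝ) : ℂ) ∂circ

/-- The vector `R a`, with coordinates `∑_m R_{l+1,m} a(m)`, `l ≥ 0`. -/
def vecRa (a : ℕ → ℂ) (f g : ℝ → ℝ) (l : ℕ) : ℂ := ∑' m : ℕ, matR f g (l + 1) m * a m

/-- `⟨Q a, a⟩`. -/
def formQ (a : ℕ → ℂ) (f g : ℝ → ℝ) : ℂ :=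
  ∑' l : ℕ, (∑' k : ℕ, matQ f g l k * a k) * conj (a l)

/-- `C(e^{iλ}) = ∑_{k ≥ 0} c(k) e^{iλ(k+1)}`: the right-hand side is the Fourier series of the
integrable function `C`. -/
def HasFutureSeries (c : ℕ → ℂ) (C : ℝ → ℂ) : Prop :=
  Integrable C circ ∧ (∀ k : ℕ, coeff C ((k : ℤ) + 1) = c k) ∧ ∀ k : ℕ, coeff C (-(k : ℤ)) = 0

/-- The operator with matrix `P`, applied to the vector `c` whose series has the sum `C`:
`(P c)_l = (1/2π) ∫ e^{-iλ(l+1)} C(e^{iλ}) / (f + g) dλ`. See `applyP_eq_matrix`. -/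
def applyP (f g : ℝ → ℝ) (C : ℝ → ℂ) (l : ℕ) : ℂ :=
  coeff (fun x => C x / ((f x + g x : ℝ) : ℂ)) ((l : ℤ) + 1)

/-- `c = P⁻¹ R a`, where `C` is the sum of the series with coefficients `c`: the vector `c` has
finite energy `⟨P c, c⟩ = (1/2π) ∫ |C|² / (f + g) dλ` and solves `P c = R a`. Since `P` is in general an
unbounded operator with unbounded inverse, its form domain, and not `ℓ₂` alone, is the space in
which the equation is uniquely solvable for all `f`, `g` with the minimality condition. -/
structure IsPInvRa (a : ℕ → ℂ) (f g : ℝ → ℝ) (c : ℕ → ℂ) (C : ℝ → ℂ) : Prop where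
  series : HasFutureSeries c C
  energy : ∫⁻ x, ‖C x‖ₑ ^ 2 * ENNReal.ofReal (1 / (f x + g x)) ∂circ < ⊤
  solves : ∀ l : ℕ, applyP f g C l = vecRa a f g l

/-- `⟨y, c⟩ = ∑_l y(l) conj c(l) = p`, the series being summed by arithmetic means. This is the
`ℓ₂` inner product if `y`, `c` are in `ℓ₂`. -/
def HasInner (y c : ℕ → ℂ) (p : ℂ) : Prop :=
  Tendsto (fun n : ℕ => (1 / (n : ℂ)) *
    ∑ m ∈ Finset.range n, ∑ l ∈ Finset.range m, y l * conj (c l)) atTop (𝓝 p)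

/-- The objective `⟨R a, P⁻¹ R a⟩ + ⟨Q a, a⟩` has the value `v`, where `c = P⁻¹ R a`. -/
def HasObjective (a : ℕ → ℂ) (f g : ℝ → ℝ) (c : ℕ → ℂ) (v : ℝ) : Prop :=
  ∃ p : ℂ, HasInner (vecRa a f g) c p ∧ (v : ℂ) = p + formQ a f g

/-- `(f0, g0)`, with `c0 = (P⁰)⁻¹ R⁰ a`, solves the problem of maximising the objective
`⟨R a, P⁻¹ R a⟩ + ⟨Q a, a⟩` over the pairs in `D` for which the operators are defined. -/
def SolvesMaxProblem (a : ℕ → ℂ) (D : Set ((ℝ → ℝ) × (ℝ → ℝ))) (f0 g0 : ℝ → ℝ)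
    (c0 : ℕ → ℂ) : Prop :=
  (f0, g0) ∈ D ∧ ∃ v0 : ℝ, HasObjective a f0 g0 c0 v0 ∧
    ∀ q ∈ D, Minimality q.1 q.2 → ∀ (c : ℕ → ℂ) (C : ℝ → ℂ) (v : ℝ),
      IsPInvRa a q.1 q.2 c C → HasObjective a q.1 q.2 c v → v ≤ v0

/-- `h(f,g) = A f / (f + g) - C / (f + g)`. -/
def charH (a : ℕ → ℂ) (f g : ℝ → ℝ) (C : ℝ → ℂ) (x : ℝ) : ℂ :=
  symbolA a x * ((f x / (f x + g x) : ℝ) : ℂ) - C x / ((f x + g x : ℝ) : ℂ)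

/-- `h_f(f,g) = |A g + C| / (f + g)`. -/
def hf (a : ℕ → ℂ) (f g : ℝ → ℝ) (C : ℝ → ℂ) (x : ℝ) : ℝ :=
  ‖symbolA a x * (g x : ℂ) + C x‖ / (f x + g x)

/-- `h_g(f,g) = |A f - C| / (f + g)`. -/
def hg (a : ℕ → ℂ) (f g : ℝ → ℝ) (C : ℝ → ℂ) (x : ℝ) : ℝ :=
  ‖symbolA a x * (f x : ℂ) - C x‖ / (f x + g x)

/-! ### The classes of admissible densities -/

/-- Densities `f` with `v ≤ f ≤ u` and `(1/2π) ∫ f dλ ≤ P₁`. -/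
def bandClass (v u : ℝ → ℝ) (P1 : ℝ) : Set (ℝ → ℝ) :=
  {f | IsSpectralDensity f ∧ (∀ᵐ x ∂circ, v x ≤ f x ∧ f x ≤ u x) ∧ ∫ x, f x ∂circ ≤ P1}

/-- Densities `g = (1 - ε) g₁ + ε w` with `w` a spectral density and `(1/2π) ∫ g dλ ≤ P₂`. -/
def contamClass (ε : ℝ) (g1 : ℝ → ℝ) (P2 : ℝ) : Set (ℝ → ℝ) :=
  {g | IsSpectralDensity g ∧
    (∃ w, IsSpectralDensity w ∧ ∀ᵐ x ∂circ, g x = (1 - ε) * g1 x + ε * w x) ∧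
    ∫ x, g x ∂circ ≤ P2}

/-! ### Stationary sequences and estimates -/

/-- `ξ`, `η` are uncorrelated zero-mean stationary sequences with spectral densities `f`, `g`. -/
structure IsSignalNoise {Ω : Type*} [MeasurableSpace Ω] (μ : Measure Ω) (ξ η : ℤ → Ω → ℂ)
    (f g : ℝ → ℝ) : Prop where
  signal_memLp : ∀ m, MemLp (ξ m) 2 μ
  noise_memLp : ∀ m, MemLp (η m) 2 μ
  signal_mean : ∀ m, ∫ ω, ξ m ω ∂μ = 0
  noise_mean : ∀ m, ∫ ω, η m ω ∂μ = 0
  signal_cov : ∀ m n, ∫ ω, ξ m ω * conj (ξ n ω) ∂μ = ∫ x, expo (m - n) x * (f x : ℂ) ∂circ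
  noise_cov : ∀ m n, ∫ ω, η m ω * conj (η n ω) ∂μ = ∫ x, expo (m - n) x * (g x : ℂ) ∂circ
  uncorrelated : ∀ m n, ∫ ω, ξ m ω * conj (η n ω) ∂μ = 0

/-- `X = A ξ = ∑_{k ≥ 0} a(k) ξ(-k)`, as a mean-square convergent series. -/
def IsFunctional {Ω : Type*} [MeasurableSpace Ω] (μ : Measure Ω) (a : ℕ → ℂ) (ξ : ℤ → Ω → ℂ)
    (X : Ω → ℂ) : Prop :=
  MemLp X 2 μ ∧
    Tendsto (fun n : ℕ => eLpNorm (fun ω => X ω - ∑ k ∈ Finset.range n, a k * ξ (-(k : ℤ)) ω) 2 μ)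
      atTop (𝓝 0)

/-- The finite combination `∑_{k ≥ 0} b(k) (ξ(-k) + η(-k))` of observations. -/
def obsComb {Ω : Type*} (ξ η : ℤ → Ω → ℂ) (b : ℕ →₀ ℂ) (ω : Ω) : ℂ :=
  ∑ k ∈ b.support, b k * (ξ (-(k : ℤ)) ω + η (-(k : ℤ)) ω)

/-- `H⁰(ξ + η)`: the closed span in `L²` of the observations `ξ(m) + η(m)`, `m ≤ 0`. -/
def obsSpace {Ω : Type*} [MeasurableSpace Ω] (μ : Measure Ω) (ξ η : ℤ → Ω → ℂ) :
    Set (Ω → ℂ) :=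
  {Y | MemLp Y 2 μ ∧
    ∀ δ : ℝ≥0∞, 0 < δ → ∃ b : ℕ →₀ ℂ, eLpNorm (fun ω => Y ω - obsComb ξ η b ω) 2 μ < δ}

/-- `Y = ∫ h(λ) dZ_{ξ+η}(λ)` for `h ∈ L₂⁰(s)`, `s` the spectral density of `ξ + η`: the stochastic
integral is the extension by continuity of `e^{imλ} ↦ ξ(m) + η(m)`, `m ≤ 0`. -/
def HasSpectralChar {Ω : Type*} [MeasurableSpace Ω] (μ : Measure Ω) (ξ η : ℤ → Ω → ℂ)
    (s : ℝ → ℝ) (h : ℝ → ℂ) (Y : Ω → ℂ) : Prop :=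
  MemLp Y 2 μ ∧ MemLp h 2 (spec s) ∧ ∃ b : ℕ → (ℕ →₀ ℂ),
    Tendsto (fun n => eLpNorm (fun x => h x - pastPoly (b n) x) 2 (spec s)) atTop (𝓝 0) ∧
    Tendsto (fun n => eLpNorm (fun ω => Y ω - obsComb ξ η (b n) ω) 2 μ) atTop (𝓝 0)

/-! ### Consistency of the action of `P` with its matrix -/

theorem continuous_expo (n : ℤ) : Continuous (expo n) := by
  unfold expo; fun_prop

theorem norm_expo (n : ℤ) (x : ℝ) : ‖expo n x‖ = 1 := by
  unfold expo
  rw [show Complex.I * ((n : ℂ) * (x : ℂ)) = (((n : ℝ) * x : ℝ) : ℂ) * Complex.I by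
    push_cast; ring]
  exact Complex.norm_exp_ofReal_mul_I _

theorem expo_mul (m n : ℤ) (x : ℝ) : expo m x * expo n x = expo (m + n) x := by
  unfold expo
  rw [← Complex.exp_add]
  congr 1
  push_cast
  ring

/-- On finitely supported vectors `applyP` is multiplication by the matrix `P`. -/
theorem applyP_eq_matrix (f g : ℝ → ℝ) (hm : Minimality f g) (c : ℕ →₀ ℂ) (l : ℕ) :
    applyP f g (fun x => ∑ k ∈ c.support, c k * expo ((k : ℤ) + 1) x) l =
      ∑ k ∈ c.support, matP f g l k * c k := by
  have key : ∀ k : ℕ, Integrable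
      (fun x => expo ((k : ℤ) - l) x * ((1 / (f x + g x) : ℝ) : ℂ) * c k) circ := by
    intro k
    refine Integrable.mul_const ?_ _
    refine Integrable.bdd_mul (c := 1) hm.2.ofReal
      (continuous_expo _).aestronglyMeasurable (Eventually.of_forall fun x => ?_)
    exact (norm_expo _ x).le
  unfold applyP coeff matP
  simp_rw [← integral_mul_const]
  rw [← integral_finsetSum _ (fun k _ => key k)]
  refine integral_congr_ae (Eventually.of_forall fun x => ?_)
  simp only [Finset.sum_div, Finset.mul_sum]
  refine Finset.sum_congr rfl fun k _ => ?_
  rw [show (k : ℤ) - l = -((l : ℤ) + 1) + ((k : ℤ) + 1) by ring,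
    ← expo_mul (-((l : ℤ) + 1)) ((k : ℤ) + 1) x]
  generalize expo (-((l : ℤ) + 1)) x = p
  generalize expo ((k : ℤ) + 1) x = q
  push_cast
  ring

end RobustFilter

end

open MeasureTheory Filter Topology
open scoped ENNReal ComplexConjugate

noncomputable section

namespace RobustFilter

/-! ### Closed spans in `L²` -/

section ClosedSpan

variable {α : Type*}

/-! Put X = A f/(f+g). Completing the square pointwise gives Δ(h; f, g) = ‖X - h‖² + ⟨|A|² f
g/(f+g)⟩ with the norm of L₂(f+g) (`mse_eq`). The optimal h is therefore the orthogonal projection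
of X to the past. Write X - h = C/(f+g). Orthogonality to the past says that C has no Fourier
coefficients of nonpositive index. Membership of h in the past forces, under minimality, the
coefficients of h of positive index to vanish, and this is the equation P c = R a. Conversely, a
bounded h with vanishing positive coefficients has Fejér means that are polynomials in e^{-iλ} and
converge boundedly a.e. along a subsequence, so h lies in L₂⁰(s) for every density s
(`memPast_of_bounded`). Since |h⁰| = h_g(f⁰, g⁰) is bounded, h⁰ is the projection for (f⁰, g⁰) and
belongs to H_D.

Orthogonality also gives ⟨R a, c⟩ = ⟨X conj C⟩ = ‖X - h‖², and ⟨Q a, a⟩ = ⟨|A|² f g/(f+g)⟩. The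
objective of the maximum problem is thus Δ(f, g) itself (`IsPInvRa.hasObjective`).

The remaining point is the saddle inequality Δ(h⁰; f, g) ≤ Δ(f⁰, g⁰) =: Δ for all (f, g) in D, with
or without minimality (`mse_le_of_optimal_convex_le`). For 0 < t < 1 the mixture (1-t)(f⁰, g⁰) +
t(f, g) lies in the convex class D and inherits minimality from (f⁰, g⁰), so its optimal
characteristic k_t has error at most Δ. The error is affine in the densities and Δ(k_t; f⁰, g⁰) = Δ
+ ‖h⁰ - k_t‖². Hence Δ(k_t; f, g) ≤ Δ and ‖h⁰ - k_t‖² = O(t). A subsequence of k_t converges to h⁰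
a.e., and Fatou's lemma gives the inequality for h⁰. Least favorability and minimax robustness
follow formally.

For the random sequences, the covariances are Gram matrices of exponentials, so e^{imλ} ↦ ξ(m) +
η(m) preserves norms and `mse` is the true mean-square error (`IsSignalNoise.exists_estimate`,
`IsSignalNoise.optErr_le`). -/

/-- The finite combination `∑ b(k) e(k)`. -/
def lincomb (e : ℕ → α → ℂ) (b : ℕ →₀ ℂ) (x : α) : ℂ := ∑ k ∈ b.support, b k * e k x

theorem lincomb_eq_sum_of_subset (e : ℕ → α → ℂ) (b : ℕ →₀ ℂ) {T : Finset ℕ} (hT : b.support ⊆ T)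
    (x : α) : lincomb e b x = ∑ k ∈ T, b k * e k x := by
  refine Finset.sum_subset hT fun k _ hk => ?_
  rw [Finsupp.notMem_support_iff.mp hk, zero_mul]

theorem lincomb_add (e : ℕ → α → ℂ) (b c : ℕ →₀ ℂ) (x : α) :
    lincomb e (b + c) x = lincomb e b x + lincomb e c x := by
  classical
  rw [lincomb_eq_sum_of_subset e (b + c) (Finsupp.support_add),
    lincomb_eq_sum_of_subset e b Finset.subset_union_left,
    lincomb_eq_sum_of_subset e c Finset.subset_union_right, ← Finset.sum_add_distrib]
  exact Finset.sum_congr rfl fun k _ => by rw [Finsupp.add_apply, add_mul]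

theorem lincomb_smul (e : ℕ → α → ℂ) (z : ℂ) (b : ℕ →₀ ℂ) (x : α) :
    lincomb e (z • b) x = z * lincomb e b x := by
  rw [lincomb_eq_sum_of_subset e (z • b) (Finsupp.support_smul), lincomb, Finset.mul_sum]
  exact Finset.sum_congr rfl fun k _ => by rw [Finsupp.smul_apply, smul_eq_mul, mul_assoc]

theorem lincomb_zero (e : ℕ → α → ℂ) (x : α) : lincomb e 0 x = 0 := by simp [lincomb]

theorem lincomb_sub (e : ℕ → α → ℂ) (b c : ℕ →₀ ℂ) (x : α) :
    lincomb e (b - c) x = lincomb e b x - lincomb e c x := by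
  rw [sub_eq_add_neg, ← neg_one_smul ℂ c, lincomb_add, lincomb_smul]
  ring

theorem lincomb_single (e : ℕ → α → ℂ) (k : ℕ) (z : ℂ) (x : α) :
    lincomb e (Finsupp.single k z) x = z * e k x := by
  rw [lincomb_eq_sum_of_subset e _ (Finsupp.support_single_subset)]
  simp

theorem lincomb_sum {ι : Type*} (e : ℕ → α → ℂ) (T : Finset ι) (b : ι → ℕ →₀ ℂ) (x : α) :
    lincomb e (∑ i ∈ T, b i) x = ∑ i ∈ T, lincomb e (b i) x := by
  classical
  induction T using Finset.induction_on with
  | empty => simp [lincomb_zero]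
  | insert i T hi ih => rw [Finset.sum_insert hi, Finset.sum_insert hi, lincomb_add, ih]

theorem lincomb_truncation (e : ℕ → α → ℂ) (a : ℕ → ℂ) (n : ℕ) (x : α) :
    lincomb e (∑ k ∈ Finset.range n, Finsupp.single k (a k)) x =
      ∑ k ∈ Finset.range n, a k * e k x := by
  rw [lincomb_sum]
  simp_rw [lincomb_single]

variable [MeasurableSpace α] {ν : Measure α} {e : ℕ → α → ℂ} {X Y Y' Z : α → ℂ}

theorem memLp_lincomb (he : ∀ k, MemLp (e k) 2 ν) (b : ℕ →₀ ℂ) : MemLp (lincomb e b) 2 ν := by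
  have : MemLp (fun x => ∑ k ∈ b.support, b k * e k x) 2 ν :=
    memLp_finsetSum _ fun k _ => (he k).const_mul (b k)
  exact this

/-- `Y` lies in the closed span of the `e k` in `L²(ν)`. -/
def InClosedSpan (ν : Measure α) (e : ℕ → α → ℂ) (Y : α → ℂ) : Prop :=
  MemLp Y 2 ν ∧ ∀ δ : ℝ≥0∞, 0 < δ → ∃ b : ℕ →₀ ℂ,
    eLpNorm (fun x => Y x - lincomb e b x) 2 ν < δ

theorem InClosedSpan.exists_seq (h : InClosedSpan ν e Y) {B : ℕ → ℝ≥0∞} (hB : ∀ n, 0 < B n) :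
    ∃ b : ℕ → ℕ →₀ ℂ, ∀ n, eLpNorm (fun x => Y x - lincomb e (b n) x) 2 ν < B n := by
  choose b hb using fun n => h.2 (B n) (hB n)
  exact ⟨b, hb⟩

theorem InClosedSpan.exists_tendsto (h : InClosedSpan ν e Y) : ∃ b : ℕ → ℕ →₀ ℂ,
    Tendsto (fun n => eLpNorm (fun x => Y x - lincomb e (b n) x) 2 ν) atTop (𝓝 0) := by
  obtain ⟨b, hb⟩ := h.exists_seq (B := fun n => ((n : ℝ≥0∞))⁻¹) (fun n => by simp)
  exact ⟨b, tendsto_of_tendsto_of_tendsto_of_le_of_le tendsto_const_nhds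
    ENNReal.tendsto_inv_nat_nhds_zero (fun _ => zero_le) fun n => (hb n).le⟩

theorem inClosedSpan_of_tendsto (hY : MemLp Y 2 ν) {b : ℕ → ℕ →₀ ℂ}
    (hb : Tendsto (fun n => eLpNorm (fun x => Y x - lincomb e (b n) x) 2 ν) atTop (𝓝 0)) :
    InClosedSpan ν e Y := by
  refine ⟨hY, fun δ hδ => ?_⟩
  obtain ⟨n, hn⟩ := ((tendsto_order.1 hb).2 δ hδ).exists
  exact ⟨b n, hn⟩

/-- Domination of measures bounds the L²(ν') norm by √c times the L²(ν) norm, so the same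
combinations approximate. This moves characteristics from a mixture of densities to its components.
-/
theorem InClosedSpan.mono {ν' : Measure α} {c : ℝ≥0∞} (hc : c ≠ ∞) (hν : ν' ≤ c • ν)
    (h : InClosedSpan ν e Y) : InClosedSpan ν' e Y := by
  obtain ⟨b, hb⟩ := h.exists_tendsto
  refine inClosedSpan_of_tendsto (b := b) (h.1.of_measure_le_smul hc hν) ?_
  have hlim : Tendsto (fun n => c ^ (1 / 2 : ℝ) *
      eLpNorm (fun x => Y x - lincomb e (b n) x) 2 ν) atTop (𝓝 0) := by
    have := ENNReal.Tendsto.const_mul (a := c ^ (1 / 2 : ℝ)) hb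
      (Or.inr (ENNReal.rpow_ne_top_of_nonneg (by norm_num) hc))
    simpa using this
  refine tendsto_of_tendsto_of_tendsto_of_le_of_le tendsto_const_nhds hlim
    (fun _ => zero_le) fun n => ?_
  refine (eLpNorm_mono_measure _ hν).trans ?_
  rw [eLpNorm_smul_measure_of_ne_top (by norm_num)]
  simp

theorem lintegral_enorm_sq (ν : Measure α) (Y : α → ℂ) :
    ∫⁻ x, ‖Y x‖ₑ ^ 2 ∂ν = eLpNorm Y 2 ν ^ 2 := by
  rw [eLpNorm_eq_lintegral_rpow_enorm_toReal (by norm_num) (by norm_num)]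
  rw [← ENNReal.rpow_natCast, ← ENNReal.rpow_mul]
  simp

/-! ### Orthogonality and projection in L² -/

theorem inner_toLp_eq (hZ : MemLp Z 2 ν) (hY : MemLp Y 2 ν) :
    inner ℂ (hY.toLp Y) (hZ.toLp Z) = ∫ x, Z x * conj (Y x) ∂ν := by
  rw [L2.inner_def]
  refine integral_congr_ae ?_
  filter_upwards [hZ.coeFn_toLp, hY.coeFn_toLp] with x h1 h2
  rw [h1, h2]; rfl

theorem exists_projection (he : ∀ k, MemLp (e k) 2 ν) (hX : MemLp X 2 ν) :
    ∃ Y, InClosedSpan ν e Y ∧ ∀ k, ∫ x, (X x - Y x) * conj (e k x) ∂ν = 0 := by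
  let E : ℕ → Lp ℂ 2 ν := fun k => (he k).toLp (e k)
  let K : Submodule ℂ (Lp ℂ 2 ν) := (Submodule.span ℂ (Set.range E)).topologicalClosure
  have : CompleteSpace K :=
    (Submodule.isClosed_topologicalClosure _).completeSpace_coe
  let y := K.starProjection (hX.toLp X)
  have hyK : y ∈ K := Submodule.starProjection_apply_mem _ _
  -- The projection lives among classes in `Lp`; every element of the span is represented a.e. by an
  -- explicit finite combination of the functions themselves.
  have key : ∀ z ∈ Submodule.span ℂ (Set.range E), ∃ b : ℕ →₀ ℂ, z =ᵐ[ν] lincomb e b := by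
    intro z hz
    induction hz using Submodule.span_induction with
    | mem z hz =>
      obtain ⟨k, rfl⟩ := hz
      refine ⟨Finsupp.single k 1, ?_⟩
      filter_upwards [(he k).coeFn_toLp] with x hx
      rw [lincomb_single, one_mul]; exact hx
    | zero =>
      refine ⟨0, ?_⟩
      filter_upwards [Lp.coeFn_zero ℂ 2 ν] with x hx
      rw [hx, lincomb_zero]; rfl
    | add z w _ _ hz hw =>
      obtain ⟨b, hb⟩ := hz
      obtain ⟨c, hc⟩ := hw
      refine ⟨b + c, ?_⟩
      filter_upwards [Lp.coeFn_add z w, hb, hc] with x h1 h2 h3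
      rw [h1, Pi.add_apply, h2, h3, lincomb_add]
    | smul r z _ hz =>
      obtain ⟨b, hb⟩ := hz
      refine ⟨r • b, ?_⟩
      filter_upwards [Lp.coeFn_smul r z, hb] with x h1 h2
      rw [h1, Pi.smul_apply, h2, lincomb_smul, smul_eq_mul]
  refine ⟨y, ⟨Lp.memLp y, fun δ hδ => ?_⟩, fun k => ?_⟩
  · have hy' : y ∈ closure (Submodule.span ℂ (Set.range E) : Set (Lp ℂ 2 ν)) := hyK
    obtain ⟨z, hz, hzδ⟩ := EMetric.mem_closure_iff.1 hy' δ hδ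
    obtain ⟨b, hb⟩ := key z hz
    refine ⟨b, ?_⟩
    rw [Lp.edist_def] at hzδ
    refine lt_of_eq_of_lt (eLpNorm_congr_ae ?_) hzδ
    filter_upwards [hb] with x hx
    simp [hx]
  · have h1 : inner ℂ (E k) (hX.toLp X - y) = 0 := by
      rw [← inner_conj_symm, Submodule.starProjection_inner_eq_zero _ _
        (Submodule.le_topologicalClosure _ (Submodule.subset_span (Set.mem_range_self k))), map_zero]
    rw [← h1, L2.inner_def]
    refine integral_congr_ae ?_
    filter_upwards [hX.coeFn_toLp, (he k).coeFn_toLp, Lp.coeFn_sub (hX.toLp X) y] with x h2 h3 h4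
    rw [h4, h3, Pi.sub_apply, h2]; rfl

theorem integrable_mul_conj (hZ : MemLp Z 2 ν) (hY : MemLp Y 2 ν) :
    Integrable (fun x => Z x * conj (Y x)) ν :=
  MemLp.integrable_mul hZ hY.star

theorem integral_mul_conj_lincomb (he : ∀ k, MemLp (e k) 2 ν) (hZ : MemLp Z 2 ν) (b : ℕ →₀ ℂ) :
    ∫ x, Z x * conj (lincomb e b x) ∂ν =
      ∑ k ∈ b.support, conj (b k) * ∫ x, Z x * conj (e k x) ∂ν := by
  simp_rw [← integral_const_mul]
  rw [← integral_finsetSum _ fun k _ => (integrable_mul_conj hZ (he k)).const_mul _]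
  refine integral_congr_ae (Eventually.of_forall fun x => ?_)
  simp only [lincomb, map_sum, map_mul, Finset.mul_sum]
  exact Finset.sum_congr rfl fun k _ => by ring

theorem enorm_integral_mul_conj_le (hZ : MemLp Z 2 ν) (hY : MemLp Y 2 ν) :
    ‖∫ x, Z x * conj (Y x) ∂ν‖ₑ ≤ eLpNorm Z 2 ν * eLpNorm Y 2 ν := by
  rw [← inner_toLp_eq hZ hY, mul_comm, ← Lp.enorm_toLp hZ, ← Lp.enorm_toLp hY]
  have := norm_inner_le_norm (𝕜 := ℂ) (hY.toLp Y) (hZ.toLp Z)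
  rw [enorm_eq_nnnorm, enorm_eq_nnnorm, enorm_eq_nnnorm, ← ENNReal.coe_mul]
  exact_mod_cast this

/-- Subtracting an approximating combination from Y does not change the pairing with Z;
Cauchy–Schwarz then bounds it by ‖Z‖ times the approximation error. -/
theorem InClosedSpan.integral_mul_conj_eq_zero (he : ∀ k, MemLp (e k) 2 ν) (hZ : MemLp Z 2 ν)
    (horth : ∀ k, ∫ x, Z x * conj (e k x) ∂ν = 0) (hY : InClosedSpan ν e Y) :
    ∫ x, Z x * conj (Y x) ∂ν = 0 := by
  obtain ⟨b, hb⟩ := hY.exists_tendsto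
  have hle : ∀ n, ‖∫ x, Z x * conj (Y x) ∂ν‖ₑ ≤
      eLpNorm Z 2 ν * eLpNorm (fun x => Y x - lincomb e (b n) x) 2 ν := by
    intro n
    have h1 : ∫ x, Z x * conj (Y x) ∂ν = ∫ x, Z x * conj (Y x - lincomb e (b n) x) ∂ν := by
      have h2 : ∫ x, Z x * conj (lincomb e (b n) x) ∂ν = 0 := by
        rw [integral_mul_conj_lincomb he hZ]
        exact Finset.sum_eq_zero fun k _ => by rw [horth, mul_zero]
      rw [← sub_zero (∫ x, Z x * conj (Y x) ∂ν), ← h2, ← integral_sub (integrable_mul_conj hZ hY.1)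
        (integrable_mul_conj hZ (memLp_lincomb he _))]
      refine integral_congr_ae (Eventually.of_forall fun x => ?_)
      simp only [map_sub]; ring
    rw [h1]
    exact enorm_integral_mul_conj_le hZ (hY.1.sub (memLp_lincomb he _))
  have hlim := ENNReal.Tendsto.const_mul (a := eLpNorm Z 2 ν) hb (Or.inr hZ.eLpNorm_ne_top)
  rw [mul_zero] at hlim
  have := ge_of_tendsto' hlim hle
  simpa using this

/-- Pythagoras' theorem for orthogonal elements of `L²`. -/
theorem eLpNorm_add_sq_of_orthogonal (hZ : MemLp Z 2 ν) (hY : MemLp Y 2 ν)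
    (horth : ∫ x, Z x * conj (Y x) ∂ν = 0) :
    eLpNorm (fun x => Z x + Y x) 2 ν ^ 2 = eLpNorm Z 2 ν ^ 2 + eLpNorm Y 2 ν ^ 2 := by
  have h := @norm_add_sq_eq_norm_sq_add_norm_sq_of_inner_eq_zero ℂ _ _ _ _
    (hY.toLp Y) (hZ.toLp Z) (by rw [inner_toLp_eq, horth])
  rw [← MemLp.toLp_add] at h
  have e1 : eLpNorm (fun x => Z x + Y x) 2 ν = ENNReal.ofReal ‖(hY.add hZ).toLp (Y + Z)‖ := by
    rw [ofReal_norm, Lp.enorm_toLp, add_comm Y Z]; rfl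
  rw [e1, ← Lp.enorm_toLp hZ, ← Lp.enorm_toLp hY, ← ofReal_norm, ← ofReal_norm,
    ← ENNReal.ofReal_pow (norm_nonneg _), ← ENNReal.ofReal_pow (norm_nonneg _),
    ← ENNReal.ofReal_pow (norm_nonneg _), ← ENNReal.ofReal_add (by positivity) (by positivity)]
  congr 1
  rw [sq, sq, sq, h]; ring

theorem eLpNorm_sub_sq_of_projection (he : ∀ k, MemLp (e k) 2 ν) (hX : MemLp X 2 ν)
    (hY : InClosedSpan ν e Y) (horth : ∀ k, ∫ x, (X x - Y x) * conj (e k x) ∂ν = 0)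
    (hY' : InClosedSpan ν e Y') :
    eLpNorm (fun x => X x - Y' x) 2 ν ^ 2 =
      eLpNorm (fun x => X x - Y x) 2 ν ^ 2 + eLpNorm (fun x => Y x - Y' x) 2 ν ^ 2 := by
  have hZ : MemLp (fun x => X x - Y x) 2 ν := hX.sub hY.1
  have hW : MemLp (fun x => Y x - Y' x) 2 ν := hY.1.sub hY'.1
  rw [← eLpNorm_add_sq_of_orthogonal hZ hW]
  · simp
  · have h1 := hY.integral_mul_conj_eq_zero he hZ horth
    have h2 := hY'.integral_mul_conj_eq_zero he hZ horth
    rw [← sub_zero (0 : ℂ)]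
    nth_rewrite 1 [← h1]
    rw [← h2, ← integral_sub (integrable_mul_conj hZ hY.1) (integrable_mul_conj hZ hY'.1)]
    refine integral_congr_ae (Eventually.of_forall fun x => ?_)
    simp only [map_sub]; ring

/-- Triangle inequality from both sides. The lower bound uses truncated subtraction, so ‖X - Y‖ may
be infinite. -/
theorem tendsto_eLpNorm_sub_of_tendsto {Yn : ℕ → α → ℂ} (hX : AEStronglyMeasurable X ν)
    (hY : MemLp Y 2 ν) (hYn : ∀ n, AEStronglyMeasurable (Yn n) ν)
    (h : Tendsto (fun n => eLpNorm (fun x => Y x - Yn n x) 2 ν) atTop (𝓝 0)) :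
    Tendsto (fun n => eLpNorm (fun x => X x - Yn n x) 2 ν) atTop
      (𝓝 (eLpNorm (fun x => X x - Y x) 2 ν)) := by
  have hup : ∀ n, eLpNorm (fun x => X x - Yn n x) 2 ν ≤
      eLpNorm (fun x => X x - Y x) 2 ν + eLpNorm (fun x => Y x - Yn n x) 2 ν := by
    intro n
    have := eLpNorm_add_le (hX.sub hY.1) (hY.1.sub (hYn n)) (p := 2) (by norm_num)
    rwa [sub_add_sub_cancel] at this
  have hlow : ∀ n, eLpNorm (fun x => X x - Y x) 2 ν - eLpNorm (fun x => Y x - Yn n x) 2 ν ≤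
      eLpNorm (fun x => X x - Yn n x) 2 ν := by
    intro n
    rw [tsub_le_iff_right]
    have := eLpNorm_add_le (hX.sub (hYn n)) ((hYn n).sub hY.1) (p := 2) (by norm_num)
    have h2 : eLpNorm (Yn n - Y) 2 ν = eLpNorm (fun x => Y x - Yn n x) 2 ν :=
      eLpNorm_sub_comm _ _ _ _
    rw [h2, sub_add_sub_cancel] at this
    exact this
  refine tendsto_of_tendsto_of_tendsto_of_le_of_le ?_ ?_ hlow hup
  · have := ENNReal.Tendsto.sub (tendsto_const_nhds (x := eLpNorm (fun x => X x - Y x) 2 ν)) h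
      (Or.inr ENNReal.zero_ne_top)
    simpa using this
  · have := (tendsto_const_nhds (x := eLpNorm (fun x => X x - Y x) 2 ν)).add h
    simpa using this

end ClosedSpan

/-! ### The normalised Lebesgue measure and exponentials -/

/-- Endpoints are null; this half-open interval is the one used by interval integrals and by the
fundamental domain of the additive circle. -/
theorem circ_eq_Ioc : circ = ENNReal.ofReal (1 / (2 * Real.pi)) •
    volume.restrict (Set.Ioc (-Real.pi) Real.pi) := by
  unfold circ
  rw [restrict_Ico_eq_restrict_Ioc]

instance isFiniteMeasure_circ : IsFiniteMeasure circ := by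
  unfold circ
  exact Measure.smul_finite _ ENNReal.ofReal_ne_top

theorem integral_circ (F : ℝ → ℂ) :
    ∫ x, F x ∂circ = ((1 / (2 * Real.pi) : ℝ) : ℂ) * ∫ x in (-Real.pi)..Real.pi, F x := by
  rw [circ_eq_Ioc, integral_smul_measure, intervalIntegral.integral_of_le
    (by linarith [Real.pi_pos]), ENNReal.toReal_ofReal (by positivity)]
  exact Complex.real_smul

theorem expo_zero (x : ℝ) : expo 0 x = 1 := by simp [expo]

theorem conj_expo (n : ℤ) (x : ℝ) : conj (expo n x) = expo (-n) x := by
  unfold expo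
  rw [← Complex.exp_conj]
  congr 1
  simp

theorem integral_expo (n : ℤ) : ∫ x, expo n x ∂circ = if n = 0 then 1 else 0 := by
  rw [integral_circ]
  have hpi : (Real.pi : ℂ) ≠ 0 := by exact_mod_cast Real.pi_ne_zero
  split_ifs with hn
  · subst hn
    simp only [expo_zero]
    simp only [intervalIntegral.integral_const, sub_neg_eq_add, Complex.real_smul]
    push_cast
    field_simp
    ring
  · have hc : Complex.I * (n : ℂ) ≠ 0 := mul_ne_zero Complex.I_ne_zero (by exact_mod_cast hn)
    have h1 : ∀ x : ℝ, expo n x = Complex.exp (Complex.I * (n : ℂ) * x) := by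
      intro x; unfold expo; ring_nf
    simp_rw [h1]
    rw [integral_exp_mul_complex hc]
    have h2 : Complex.exp (Complex.I * (n : ℂ) * (Real.pi : ℝ)) =
        Complex.exp (Complex.I * (n : ℂ) * ((-Real.pi : ℝ) : ℂ)) := by
      rw [Complex.exp_eq_exp_iff_exists_int]
      exact ⟨n, by push_cast; ring⟩
    rw [h2, sub_self, zero_div, mul_zero]

theorem integrable_expo_mul {F : ℝ → ℂ} {ν : Measure ℝ} (hF : Integrable F ν) (n : ℤ) :
    Integrable (fun x => expo n x * F x) ν :=
  hF.bdd_mul (c := 1) (continuous_expo n).aestronglyMeasurable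
    (Eventually.of_forall fun x => (norm_expo n x).le)

theorem integrable_expo {ν : Measure ℝ} [IsFiniteMeasure ν] (n : ℤ) : Integrable (expo n) ν := by
  simpa using integrable_expo_mul (integrable_const (1 : ℂ)) n

theorem memLp_expo {ν : Measure ℝ} [IsFiniteMeasure ν] (n : ℤ) : MemLp (expo n) 2 ν :=
  MemLp.of_bound (continuous_expo n).aestronglyMeasurable 1
    (Eventually.of_forall fun x => (norm_expo n x).le)

theorem coeff_expo (j m : ℤ) : coeff (expo j) m = if m = j then 1 else 0 := by
  unfold coeff
  simp_rw [expo_mul]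
  rw [integral_expo]
  congr 1
  rw [eq_iff_iff]
  omega

theorem coeff_add {F G : ℝ → ℂ} (hF : Integrable F circ) (hG : Integrable G circ) (m : ℤ) :
    coeff (fun x => F x + G x) m = coeff F m + coeff G m := by
  unfold coeff
  rw [← integral_add (integrable_expo_mul hF _) (integrable_expo_mul hG _)]
  simp_rw [mul_add]

theorem coeff_sub {F G : ℝ → ℂ} (hF : Integrable F circ) (hG : Integrable G circ) (m : ℤ) :
    coeff (fun x => F x - G x) m = coeff F m - coeff G m := by
  unfold coeff
  rw [← integral_sub (integrable_expo_mul hF _) (integrable_expo_mul hG _)]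
  simp_rw [mul_sub]

theorem coeff_const_mul (z : ℂ) (F : ℝ → ℂ) (m : ℤ) :
    coeff (fun x => z * F x) m = z * coeff F m := by
  unfold coeff
  rw [← integral_const_mul]
  congr 1; ext x; ring

theorem coeff_congr {F G : ℝ → ℂ} (h : F =ᵐ[circ] G) (m : ℤ) : coeff F m = coeff G m :=
  integral_congr_ae (h.mono fun x hx => by simp only [hx])

/-! ### Fejér means -/

/-- The Fejér mean `∑_{|j| < n} (1 - |j| / n) F̂(j) e^{ijx}`. -/
def fejer (n : ℕ) (F : ℝ → ℂ) (x : ℝ) : ℂ :=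
  (1 / (n : ℂ)) * ∑ p ∈ Finset.range n, ∑ q ∈ Finset.range n,
    coeff F ((p : ℤ) - q) * expo ((p : ℤ) - q) x

/-- The Fejér kernel at `x - y`. -/
def fejerKernel (n : ℕ) (x y : ℝ) : ℝ :=
  (1 / (n : ℝ)) * ‖∑ p ∈ Finset.range n, expo (p : ℤ) x * expo (-(p : ℤ)) y‖ ^ 2

theorem fejerKernel_nonneg (n : ℕ) (x y : ℝ) : 0 ≤ fejerKernel n x y := by
  unfold fejerKernel; positivity

theorem fejerKernel_comm (n : ℕ) (x y : ℝ) : fejerKernel n x y = fejerKernel n y x := by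
  unfold fejerKernel
  rw [← Complex.norm_conj (∑ p ∈ Finset.range n, expo (p : ℤ) x * expo (-(p : ℤ)) y)]
  simp_rw [map_sum, map_mul, conj_expo, neg_neg, mul_comm]

theorem continuous_fejerKernel (n : ℕ) : Continuous fun z : ℝ × ℝ => fejerKernel n z.1 z.2 := by
  unfold fejerKernel
  have := continuous_expo
  fun_prop

/-- The squared modulus shows that the kernel is nonnegative; its expansion, in which a difference p
- q = j with |j| < n occurs n - |j| times, shows that it produces the Fejér weights. -/
theorem fejerKernel_eq (n : ℕ) (x y : ℝ) : (fejerKernel n x y : ℂ) =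
    (1 / (n : ℂ)) * ∑ p ∈ Finset.range n, ∑ q ∈ Finset.range n,
      expo ((p : ℤ) - q) x * expo (-((p : ℤ) - q)) y := by
  unfold fejerKernel
  push_cast
  rw [← Complex.mul_conj', map_sum, Finset.sum_mul_sum]
  congr 1
  refine Finset.sum_congr rfl fun p _ => Finset.sum_congr rfl fun q _ => ?_
  rw [map_mul, conj_expo, conj_expo, sub_eq_add_neg, ← expo_mul, neg_add, ← expo_mul]
  ring

theorem integral_fejerKernel {n : ℕ} (hn : n ≠ 0) (x : ℝ) : ∫ y, fejerKernel n x y ∂circ = 1 := by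
  have hn' : (n : ℂ) ≠ 0 := by exact_mod_cast hn
  have h : ((∫ y, fejerKernel n x y ∂circ : ℝ) : ℂ) = 1 := by
    rw [← integral_complex_ofReal]
    simp_rw [fejerKernel_eq]
    rw [integral_const_mul, integral_finsetSum _ fun p _ => integrable_finsetSum _ fun q _ =>
      (integrable_expo _).const_mul _]
    have : ∀ p ∈ Finset.range n, ∫ y, ∑ q ∈ Finset.range n,
        expo ((p : ℤ) - q) x * expo (-((p : ℤ) - q)) y ∂circ = 1 := by
      intro p hp
      rw [integral_finsetSum _ fun q _ => (integrable_expo _).const_mul _]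
      simp_rw [integral_const_mul, integral_expo]
      rw [Finset.sum_eq_single p]
      · simp [expo_zero]
      · intro q _ hq
        rw [if_neg (by omega), mul_zero]
      · intro h; exact absurd hp h
    rw [Finset.sum_congr rfl this]
    simp [hn']
  exact_mod_cast h

theorem integrable_fejerKernel_mul {F : ℝ → ℂ} (hF : Integrable F circ) (n : ℕ) (x : ℝ) :
    Integrable (fun y => (fejerKernel n x y : ℂ) * F y) circ := by
  simp_rw [fejerKernel_eq, mul_assoc, Finset.sum_mul]
  refine Integrable.const_mul (integrable_finsetSum _ fun p _ => integrable_finsetSum _ fun q _ => ?_) _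
  simp_rw [mul_assoc]
  exact (integrable_expo_mul hF _).const_mul _

theorem fejer_eq_integral {F : ℝ → ℂ} (hF : Integrable F circ) (n : ℕ) (x : ℝ) :
    fejer n F x = ∫ y, (fejerKernel n x y : ℂ) * F y ∂circ := by
  have h1 : ∀ p q : ℕ, Integrable (fun y => expo ((p : ℤ) - q) x *
      (expo (-((p : ℤ) - q)) y * F y)) circ := fun p q => (integrable_expo_mul hF _).const_mul _
  simp_rw [fejerKernel_eq, mul_assoc, Finset.sum_mul, mul_assoc]
  rw [integral_const_mul, integral_finsetSum _ fun p _ => integrable_finsetSum _ fun q _ => h1 p q]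
  simp_rw [integral_finsetSum _ fun q _ => h1 _ q, integral_const_mul]
  unfold fejer coeff
  congr 1
  exact Finset.sum_congr rfl fun p _ => Finset.sum_congr rfl fun q _ => mul_comm _ _

theorem continuous_fejer (n : ℕ) (F : ℝ → ℂ) : Continuous (fejer n F) := by
  unfold fejer
  have := continuous_expo
  fun_prop

theorem norm_fejer_le {F : ℝ → ℂ} (hF : Integrable F circ) {M : ℝ} (hM0 : 0 ≤ M)
    (hM : ∀ᵐ x ∂circ, ‖F x‖ ≤ M) (n : ℕ) (x : ℝ) : ‖fejer n F x‖ ≤ M := by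
  -- For n = 0 the factor 1/n is 0, so the mean vanishes although the kernel no longer has mass one.
  rcases eq_or_ne n 0 with rfl | hn
  · simpa [fejer] using hM0
  rw [fejer_eq_integral hF]
  have hK : Integrable (fun y => fejerKernel n x y) circ := by
    have h1 := integrable_fejerKernel_mul (integrable_const (1 : ℂ)) n x
    simp only [mul_one] at h1
    exact h1.re
  calc ‖∫ y, (fejerKernel n x y : ℂ) * F y ∂circ‖
      ≤ ∫ y, fejerKernel n x y * M ∂circ := by
        refine norm_integral_le_of_norm_le (hK.mul_const M) ?_
        filter_upwards [hM] with y hy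
        rw [norm_mul, Complex.norm_real, Real.norm_of_nonneg (fejerKernel_nonneg _ _ _)]
        exact mul_le_mul_of_nonneg_left hy (fejerKernel_nonneg _ _ _)
    _ = M := by rw [integral_mul_const, integral_fejerKernel hn, one_mul]

/-- The kernel is nonnegative and symmetric with mass one in either variable, so Tonelli makes the
Fejér means contractions of L¹, uniformly in n. -/
theorem lintegral_enorm_fejer_le {F : ℝ → ℂ} (hF : Integrable F circ) (n : ℕ) :
    ∫⁻ x, ‖fejer n F x‖ₑ ∂circ ≤ ∫⁻ x, ‖F x‖ₑ ∂circ := by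
  rcases eq_or_ne n 0 with rfl | hn
  · simp [fejer]
  have hKm := (continuous_fejerKernel n).measurable
  have h1 : ∀ x, ‖fejer n F x‖ₑ ≤ ∫⁻ y, ENNReal.ofReal (fejerKernel n x y) * ‖F y‖ₑ ∂circ := by
    intro x
    rw [fejer_eq_integral hF]
    refine (enorm_integral_le_lintegral_enorm _).trans (lintegral_mono fun y => ?_)
    rw [enorm_mul, ← ofReal_norm (fejerKernel n x y : ℂ), Complex.norm_real,
      Real.norm_of_nonneg (fejerKernel_nonneg _ _ _)]
  refine (lintegral_mono h1).trans ?_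
  rw [lintegral_lintegral_swap]
  · refine lintegral_mono fun y => ?_
    have hm : Measurable fun x => ENNReal.ofReal (fejerKernel n x y) :=
      (hKm.comp measurable_prodMk_right).ennreal_ofReal
    rw [lintegral_mul_const _ hm]
    have h2 : ∫⁻ x, ENNReal.ofReal (fejerKernel n x y) ∂circ = 1 := by
      have hK : Integrable (fun x => fejerKernel n y x) circ := by
        have h1 := integrable_fejerKernel_mul (integrable_const (1 : ℂ)) n y
        simp only [mul_one] at h1
        exact h1.re
      simp_rw [fejerKernel_comm n _ y]
      rw [← ofReal_integral_eq_lintegral_ofReal hK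
        (Eventually.of_forall fun x => fejerKernel_nonneg _ _ _), integral_fejerKernel hn,
        ENNReal.ofReal_one]
    rw [h2, one_mul]
  · exact hKm.ennreal_ofReal.aemeasurable.mul hF.1.enorm.comp_snd

theorem fejer_add {F G : ℝ → ℂ} (hF : Integrable F circ) (hG : Integrable G circ) (n : ℕ) (x : ℝ) :
    fejer n (fun x => F x + G x) x = fejer n F x + fejer n G x := by
  unfold fejer
  simp_rw [coeff_add hF hG, add_mul, Finset.sum_add_distrib]
  ring

theorem fejer_sub {F G : ℝ → ℂ} (hF : Integrable F circ) (hG : Integrable G circ) (n : ℕ) (x : ℝ) :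
    fejer n (fun x => F x - G x) x = fejer n F x - fejer n G x := by
  unfold fejer
  simp_rw [coeff_sub hF hG, sub_mul, Finset.sum_sub_distrib]
  ring

theorem fejer_const_mul (z : ℂ) (F : ℝ → ℂ) (n : ℕ) (x : ℝ) :
    fejer n (fun x => z * F x) x = z * fejer n F x := by
  unfold fejer
  simp_rw [coeff_const_mul, mul_assoc, ← Finset.mul_sum]
  ring

/-- In row p of the double sum only q = p - j contributes, provided that it lies in [0, n). The mean
is therefore e^{ijx} times the proportion of rows that have such a q. The exceptional rows lie among
the first |j| and the last |j|, whence the crude constant 2|j|. -/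
theorem fejer_expo_sub (j : ℤ) {n : ℕ} (hn : n ≠ 0) (x : ℝ) :
    ‖fejer n (expo j) x - expo j x‖ ≤ 2 * j.natAbs / n := by
  have hn' : (n : ℝ) ≠ 0 := by exact_mod_cast hn
  have hnc : (n : ℂ) ≠ 0 := by exact_mod_cast hn
  have h1 : ∀ p ∈ Finset.range n, ∑ q ∈ Finset.range n,
      coeff (expo j) ((p : ℤ) - q) * expo ((p : ℤ) - q) x =
        (if (p : ℤ) < j ∨ (n : ℤ) ≤ p - j then 0 else 1) * expo j x := by
    intro p hp
    have hp' := Finset.mem_range.1 hp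
    simp_rw [coeff_expo]
    split_ifs with h
    · rw [zero_mul]
      refine Finset.sum_eq_zero fun q hq => ?_
      have := Finset.mem_range.1 hq
      rw [if_neg (by omega), zero_mul]
    · push Not at h
      rw [Finset.sum_eq_single ((p : ℤ) - j).toNat]
      · rw [show (p : ℤ) - ((p : ℤ) - j).toNat = j by omega, if_pos rfl]
      · intro q _ hq
        rw [if_neg (by omega), zero_mul]
      · intro h'
        exact absurd (Finset.mem_range.2 (by omega)) h'
  have h2 : fejer n (expo j) x - expo j x = -((1 / (n : ℂ)) * (∑ p ∈ Finset.range n,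
      (if (p : ℤ) < j ∨ (n : ℤ) ≤ p - j then 1 else 0)) * expo j x) := by
    unfold fejer
    rw [Finset.sum_congr rfl h1, ← Finset.sum_mul]
    have h3 : (∑ p ∈ Finset.range n, (if (p : ℤ) < j ∨ (n : ℤ) ≤ p - j then (0 : ℂ) else 1)) =
        n - ∑ p ∈ Finset.range n, (if (p : ℤ) < j ∨ (n : ℤ) ≤ p - j then (1 : ℂ) else 0) := by
      rw [eq_sub_iff_add_eq, ← Finset.sum_add_distrib]
      rw [Finset.sum_congr rfl (g := fun _ => (1 : ℂ)) fun p _ => by split_ifs <;> simp]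
      simp
    rw [h3]
    field_simp
    ring
  rw [h2, norm_neg, norm_mul, norm_mul, norm_expo, mul_one, ← Finset.natCast_card_filter,
    norm_div, norm_one, Complex.norm_natCast, Complex.norm_natCast, one_div, inv_mul_eq_div]
  gcongr
  have hcard : (Finset.filter (fun p : ℕ => (p : ℤ) < j ∨ (n : ℤ) ≤ p - j)
      (Finset.range n)).card ≤ 2 * j.natAbs := by
    have hsub : Finset.filter (fun p : ℕ => (p : ℤ) < j ∨ (n : ℤ) ≤ p - j) (Finset.range n) ⊆
        Finset.range j.natAbs ∪ Finset.Ico (n - j.natAbs) n := by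
      intro p hp
      rw [Finset.mem_filter, Finset.mem_range] at hp
      rw [Finset.mem_union, Finset.mem_range, Finset.mem_Ico]
      omega
    refine (Finset.card_le_card hsub).trans ((Finset.card_union_le _ _).trans ?_)
    rw [Finset.card_range, Nat.card_Ico]
    omega
  exact_mod_cast hcard

/-! ### Convergence of Fejér means -/

instance fact_two_pi_pos : Fact (0 < 2 * Real.pi) := ⟨by positivity⟩

/-- Transfers to the line the density of trigonometric polynomials in L¹ of the circle. -/
theorem measurePreserving_circ : MeasurePreserving ((↑) : ℝ → AddCircle (2 * Real.pi)) circ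
    (AddCircle.haarAddCircle (T := 2 * Real.pi)) := by
  have h := AddCircle.measurePreserving_mk (2 * Real.pi) (-Real.pi)
  rw [show -Real.pi + 2 * Real.pi = Real.pi by ring] at h
  have h2 := h.smul_measure (ENNReal.ofReal (1 / (2 * Real.pi)))
  rw [← circ_eq_Ioc, AddCircle.volume_eq_smul_haarAddCircle, smul_smul,
    ← ENNReal.ofReal_mul (by positivity), one_div,
    inv_mul_cancel₀ (by positivity), ENNReal.ofReal_one, one_smul] at h2
  exact h2

theorem fejer_congr {F G : ℝ → ℂ} (h : F =ᵐ[circ] G) (n : ℕ) : fejer n F = fejer n G := by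
  funext x
  unfold fejer
  simp_rw [coeff_congr h]

/-- The Fejér means of `F` converge to `F` in `L¹`. -/
def FejerTendsto (F : ℝ → ℂ) : Prop :=
  Tendsto (fun n => ∫⁻ x, ‖fejer n F x - F x‖ₑ ∂circ) atTop (𝓝 0)

theorem FejerTendsto.congr {F G : ℝ → ℂ} (hF : FejerTendsto F) (h : F =ᵐ[circ] G) :
    FejerTendsto G := by
  refine Tendsto.congr (fun n => lintegral_congr_ae ?_) hF
  filter_upwards [h] with x hx
  rw [fejer_congr h, hx]

theorem FejerTendsto.add {F G : ℝ → ℂ} (hF : Integrable F circ) (hG : Integrable G circ)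
    (h1 : FejerTendsto F) (h2 : FejerTendsto G) : FejerTendsto (fun x => F x + G x) := by
  have h := Tendsto.add h1 h2
  rw [add_zero] at h
  refine tendsto_of_tendsto_of_tendsto_of_le_of_le tendsto_const_nhds h (fun _ => zero_le)
    fun n => ?_
  have hm : AEMeasurable (fun x => ‖fejer n F x - F x‖ₑ) circ :=
    ((continuous_fejer n F).aestronglyMeasurable.sub hF.1).enorm
  rw [← lintegral_add_left' hm]
  refine lintegral_mono fun x => ?_
  rw [fejer_add hF hG]
  refine le_of_eq_of_le ?_ (enorm_add_le _ _)
  congr 1; ring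

theorem FejerTendsto.const_mul {F : ℝ → ℂ} (h : FejerTendsto F) (z : ℂ) :
    FejerTendsto (fun x => z * F x) := by
  have h' := ENNReal.Tendsto.const_mul (a := ‖z‖ₑ) h (Or.inr (enorm_ne_top))
  rw [mul_zero] at h'
  refine h'.congr fun n => ?_
  rw [← lintegral_const_mul' _ _ enorm_ne_top]
  refine lintegral_congr fun x => ?_
  rw [fejer_const_mul, ← mul_sub, enorm_mul]

theorem fejerTendsto_expo (j : ℤ) : FejerTendsto (expo j) := by
  have hlim : Tendsto (fun n : ℕ => ENNReal.ofReal (2 * j.natAbs / n) * circ Set.univ) atTop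
      (𝓝 0) := by
    have h1 := ENNReal.tendsto_ofReal (tendsto_const_div_atTop_nhds_zero_nat (2 * j.natAbs : ℝ))
    have h2 := ENNReal.Tendsto.mul_const (b := circ Set.univ) h1 (Or.inr (measure_ne_top _ _))
    simpa using h2
  refine tendsto_of_tendsto_of_tendsto_of_le_of_le' tendsto_const_nhds hlim
    (Eventually.of_forall fun _ => zero_le) ?_
  filter_upwards [eventually_ne_atTop 0] with n hn
  rw [← lintegral_const]
  refine lintegral_mono fun x => ?_
  rw [← ofReal_norm]
  exact ENNReal.ofReal_le_ofReal (fejer_expo_sub j hn x)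

/-- A three-term estimate: the means of F - G are controlled by the L¹ contraction independently of
n. -/
theorem fejerTendsto_of_approx {F : ℝ → ℂ} (hF : Integrable F circ)
    (h : ∀ δ : ℝ≥0∞, 0 < δ → ∃ G, Integrable G circ ∧ FejerTendsto G ∧
      ∫⁻ x, ‖F x - G x‖ₑ ∂circ ≤ δ) : FejerTendsto F := by
  rw [FejerTendsto, ENNReal.tendsto_nhds_zero]
  intro δ hδ
  obtain ⟨G, hG, hGt, hFG⟩ := h (δ / 3) (ENNReal.div_pos hδ.ne' (by norm_num))
  filter_upwards [(ENNReal.tendsto_nhds_zero.1 hGt) (δ / 3) (ENNReal.div_pos hδ.ne' (by norm_num))]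
    with n hn
  have hD : Integrable (fun x => F x - G x) circ := hF.sub hG
  have hm1 : AEMeasurable (fun x => ‖fejer n (fun x => F x - G x) x‖ₑ) circ :=
    (continuous_fejer n _).aestronglyMeasurable.enorm
  have hm2 : AEMeasurable (fun x => ‖fejer n G x - G x‖ₑ) circ :=
    ((continuous_fejer n G).aestronglyMeasurable.sub hG.1).enorm
  calc ∫⁻ x, ‖fejer n F x - F x‖ₑ ∂circ
      ≤ ∫⁻ x, (‖fejer n (fun x => F x - G x) x‖ₑ + (‖fejer n G x - G x‖ₑ + ‖F x - G x‖ₑ)) ∂circ := by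
        refine lintegral_mono fun x => ?_
        rw [fejer_sub hF hG, ← enorm_neg (F x - G x)]
        refine le_trans (le_of_eq_of_le ?_ (enorm_add_le _ _))
          (add_le_add_right (enorm_add_le _ _) _)
        congr 1; ring
    _ = ∫⁻ x, ‖fejer n (fun x => F x - G x) x‖ₑ ∂circ +
          (∫⁻ x, ‖fejer n G x - G x‖ₑ ∂circ + ∫⁻ x, ‖F x - G x‖ₑ ∂circ) := by
        rw [lintegral_add_left' hm1, lintegral_add_left' hm2]
    _ ≤ δ / 3 + (δ / 3 + δ / 3) :=
        add_le_add ((lintegral_enorm_fejer_le hD n).trans hFG) (add_le_add hn hFG)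
    _ = δ := by rw [← add_assoc, ENNReal.add_thirds]

/-- Fejér's theorem in `L¹`. -/
theorem fejerTendsto {F : ℝ → ℂ} (hF : Integrable F circ) : FejerTendsto F := by
  have hmp := measurePreserving_circ
  have hcomp : ∀ z : Lp ℂ 1 (AddCircle.haarAddCircle (T := 2 * Real.pi)),
      Integrable (fun x : ℝ => z (x : AddCircle (2 * Real.pi))) circ := fun z =>
    hmp.integrable_comp_of_integrable (memLp_one_iff_integrable.1 (Lp.memLp z))
  -- Convergence is explicit for exponentials and linear, hence holds on trigonometric polynomials;
  -- density and contraction do the rest.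
  have hspan : ∀ z ∈ Submodule.span ℂ (Set.range (@fourierLp (2 * Real.pi) _ 1 _)),
      FejerTendsto (fun x : ℝ => z (x : AddCircle (2 * Real.pi))) := by
    intro z hz
    induction hz using Submodule.span_induction with
    | mem z hz =>
      obtain ⟨j, rfl⟩ := hz
      refine (fejerTendsto_expo j).congr ?_
      filter_upwards [hmp.quasiMeasurePreserving.ae (coeFn_fourierLp 1 j)] with x hx
      rw [hx, fourier_coe_apply, expo]
      congr 1
      have : (Real.pi : ℂ) ≠ 0 := by exact_mod_cast Real.pi_ne_zero
      push_cast
      field_simp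
    | zero =>
      refine ((fejerTendsto_expo 0).const_mul 0).congr ?_
      filter_upwards [hmp.quasiMeasurePreserving.ae (Lp.coeFn_zero ℂ 1 _)] with x hx
      rw [hx, zero_mul]; rfl
    | add z w _ _ hz hw =>
      refine (hz.add (hcomp z) (hcomp w) hw).congr ?_
      filter_upwards [hmp.quasiMeasurePreserving.ae (Lp.coeFn_add z w)] with x hx
      rw [hx]; rfl
    | smul r z _ hz =>
      refine (hz.const_mul r).congr ?_
      filter_upwards [hmp.quasiMeasurePreserving.ae (Lp.coeFn_smul r z)] with x hx
      rw [hx]; rfl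
  have hlift : MemLp (AddCircle.liftIoc (2 * Real.pi) (-Real.pi) F) 1
      (AddCircle.haarAddCircle (T := 2 * Real.pi)) := by
    refine MemLp.haarAddCircle (MemLp.memLp_liftIoc ?_)
    rw [show -Real.pi + 2 * Real.pi = Real.pi by ring]
    have h1 := memLp_one_iff_integrable.2 hF
    rw [circ_eq_Ioc] at h1
    -- The lift is tested against unnormalised Lebesgue measure, so the factor 1/2π in `circ` is
    -- undone.
    have h2 := h1.smul_measure (c := ENNReal.ofReal (2 * Real.pi)) ENNReal.ofReal_ne_top
    rwa [smul_smul, ← ENNReal.ofReal_mul (by positivity), one_div,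
      mul_inv_cancel₀ (by positivity), ENNReal.ofReal_one, one_smul] at h2
  refine fejerTendsto_of_approx hF fun δ hδ => ?_
  have htop := @span_fourierLp_closure_eq_top (2 * Real.pi) _ 1 _ (by norm_num)
  have hmem : hlift.toLp _ ∈ closure
      (Submodule.span ℂ (Set.range (@fourierLp (2 * Real.pi) _ 1 _)) : Set (Lp ℂ 1 _)) := by
    rw [← Submodule.topologicalClosure_coe, htop]; trivial
  obtain ⟨z, hz, hzδ⟩ := EMetric.mem_closure_iff.1 hmem δ hδ
  refine ⟨_, hcomp z, hspan z hz, ?_⟩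
  rw [Lp.edist_def, eLpNorm_one_eq_lintegral_enorm] at hzδ
  refine le_of_eq_of_le ?_ hzδ.le
  have hm : AEMeasurable (fun t => ‖(⇑(hlift.toLp _) - ⇑z) t‖ₑ)
      (AddCircle.haarAddCircle (T := 2 * Real.pi)) :=
    ((Lp.aestronglyMeasurable _).sub (Lp.aestronglyMeasurable _)).enorm
  have hpull : ∀ Φ : AddCircle (2 * Real.pi) → ℝ≥0∞, AEMeasurable Φ AddCircle.haarAddCircle →
      ∫⁻ t, Φ t ∂AddCircle.haarAddCircle = ∫⁻ x : ℝ, Φ (x : AddCircle (2 * Real.pi)) ∂circ := by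
    intro Φ hΦ
    rw [← hmp.map_eq] at hΦ ⊢
    exact lintegral_map' hΦ hmp.measurable.aemeasurable
  rw [hpull _ hm]
  have hIoc : ∀ᵐ x ∂circ, x ∈ Set.Ioc (-Real.pi) Real.pi := by
    rw [circ_eq_Ioc]
    exact Measure.ae_smul_measure (ae_restrict_mem measurableSet_Ioc) _
  refine lintegral_congr_ae ?_
  filter_upwards [hIoc, hmp.quasiMeasurePreserving.ae hlift.coeFn_toLp] with x hx1 hx2
  rw [Pi.sub_apply, hx2, AddCircle.liftIoc_coe_apply (by
    rwa [show -Real.pi + 2 * Real.pi = Real.pi by ring])]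

theorem integrable_conj {G : ℝ → ℂ} {ν : Measure ℝ} (hG : Integrable G ν) :
    Integrable (fun x => conj (G x)) ν :=
  (LinearIsometryEquiv.integrable_comp_iff Complex.conjLIE).2 hG

/-! ### Summation of products of Fourier coefficients -/

theorem integral_mul_conj_fejer {F C : ℝ → ℂ} (hF : Integrable F circ) (n : ℕ) :
    ∫ x, F x * conj (fejer n C x) ∂circ = (1 / (n : ℂ)) * ∑ p ∈ Finset.range n,
      ∑ q ∈ Finset.range n, coeff F ((p : ℤ) - q) * conj (coeff C ((p : ℤ) - q)) := by
  have hi : ∀ p q : ℕ, Integrable (fun x => conj (coeff C ((p : ℤ) - q)) *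
      (expo (-((p : ℤ) - q)) x * F x)) circ := fun p q => (integrable_expo_mul hF _).const_mul _
  have h1 : ∀ x, F x * conj (fejer n C x) = (1 / (n : ℂ)) * ∑ p ∈ Finset.range n,
      ∑ q ∈ Finset.range n, conj (coeff C ((p : ℤ) - q)) * (expo (-((p : ℤ) - q)) x * F x) := by
    intro x
    unfold fejer
    simp only [map_mul, map_sum, map_div₀, map_one, Complex.conj_natCast, conj_expo]
    rw [mul_left_comm, Finset.mul_sum]
    congr 1
    refine Finset.sum_congr rfl fun p _ => ?_
    rw [Finset.mul_sum]
    exact Finset.sum_congr rfl fun q _ => by ring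
  simp_rw [h1]
  rw [integral_const_mul, integral_finsetSum _ fun p _ => integrable_finsetSum _ fun q _ => hi p q]
  congr 1
  refine Finset.sum_congr rfl fun p _ => ?_
  rw [integral_finsetSum _ fun q _ => hi p q]
  refine Finset.sum_congr rfl fun q _ => ?_
  rw [integral_const_mul, mul_comm]; rfl

/-- In row m the entries with q ≥ m carry coefficients of C of nonpositive index and vanish. The
remaining differences m - q run through 1, ..., m, so the row is a partial sum of the product series
and the Fejér weights are exactly the arithmetic means of `HasInner`. -/
theorem integral_mul_conj_fejer_of_future {F C : ℝ → ℂ} (hF : Integrable F circ)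
    (hC : ∀ k : ℕ, coeff C (-(k : ℤ)) = 0) (n : ℕ) :
    ∫ x, F x * conj (fejer n C x) ∂circ = (1 / (n : ℂ)) * ∑ m ∈ Finset.range n,
      ∑ l ∈ Finset.range m, coeff F ((l : ℤ) + 1) * conj (coeff C ((l : ℤ) + 1)) := by
  rw [integral_mul_conj_fejer hF]
  congr 1
  refine Finset.sum_congr rfl fun m hm => ?_
  have hsub : Finset.range m ⊆ Finset.range n :=
    Finset.range_subset_range.2 (Finset.mem_range.1 hm).le
  rw [← Finset.sum_subset hsub, ← Finset.sum_range_reflect]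
  · refine Finset.sum_congr rfl fun q hq => ?_
    have hq' := Finset.mem_range.1 hq
    rw [show (m : ℤ) - ((m - 1 - q : ℕ) : ℤ) = (q : ℤ) + 1 by omega]
  · intro q _ hq
    rw [Finset.mem_range, not_lt] at hq
    rw [show (m : ℤ) - q = -((q - m : ℕ) : ℤ) by omega, hC, map_zero, mul_zero]

/-- If `F` is bounded and `C` is integrable without coefficients of nonpositive index, the product
series of their coefficients is summable by arithmetic means. -/
theorem hasInner_of_bounded {F C : ℝ → ℂ} (hF : Integrable F circ) {M : ℝ}
    (hM : ∀ᵐ x ∂circ, ‖F x‖ ≤ M) (hCi : Integrable C circ)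
    (hC : ∀ k : ℕ, coeff C (-(k : ℤ)) = 0) :
    HasInner (fun l => coeff F ((l : ℤ) + 1)) (fun l => coeff C ((l : ℤ) + 1))
      (∫ x, F x * conj (C x) ∂circ) := by
  unfold HasInner
  simp_rw [← integral_mul_conj_fejer_of_future hF hC]
  -- Pairing with the bounded F is continuous in L¹, and there the Fejér means of C converge to C.
  have hlim := fejerTendsto hCi
  have hb : ∀ᵐ x ∂circ, ‖F x‖ₑ ≤ ENNReal.ofReal M := by
    filter_upwards [hM] with x hx
    rw [← ofReal_norm]
    exact ENNReal.ofReal_le_ofReal hx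
  have hi : ∀ G : ℝ → ℂ, Integrable G circ → Integrable (fun x => F x * conj (G x)) circ :=
    fun G hG => (integrable_conj hG).bdd_mul hF.1 hM
  have hfi : ∀ n, Integrable (fejer n C) circ := by
    intro n
    unfold fejer
    exact Integrable.const_mul (integrable_finsetSum _ fun p _ => integrable_finsetSum _ fun q _ =>
      (integrable_expo _).const_mul _) _
  rw [tendsto_iff_edist_tendsto_0]
  have hlim' := ENNReal.Tendsto.const_mul (a := ENNReal.ofReal M) hlim
    (Or.inr ENNReal.ofReal_ne_top)
  rw [mul_zero] at hlim'
  refine tendsto_of_tendsto_of_tendsto_of_le_of_le tendsto_const_nhds hlim' (fun _ => zero_le)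
    fun n => ?_
  rw [edist_eq_enorm_sub, ← integral_sub (hi _ (hfi n)) (hi _ hCi),
    ← lintegral_const_mul' _ _ ENNReal.ofReal_ne_top]
  refine (enorm_integral_le_lintegral_enorm _).trans (lintegral_mono_ae ?_)
  filter_upwards [hb] with x hx
  rw [← mul_sub, ← map_sub, enorm_mul]
  refine mul_le_mul' hx (le_of_eq ?_)
  rw [← ofReal_norm, Complex.norm_conj, ofReal_norm]

section SpectralMeasure

/-! ### Spectral measures -/

variable {a : ℕ → ℂ} {f g s : ℝ → ℝ} {h h' : ℝ → ℂ}

theorem IsSpectralDensity.add (hf : IsSpectralDensity f) (hg : IsSpectralDensity g) :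
    IsSpectralDensity (fun x => f x + g x) := by
  refine ⟨hf.1.add hg.1, ?_⟩
  filter_upwards [hf.2, hg.2] with x h1 h2
  exact add_nonneg h1 h2

theorem IsSpectralDensity.const_mul (hf : IsSpectralDensity f) {t : ℝ} (ht : 0 ≤ t) :
    IsSpectralDensity (fun x => t * f x) := by
  refine ⟨hf.1.const_mul t, ?_⟩
  filter_upwards [hf.2] with x h1
  exact mul_nonneg ht h1

theorem IsSpectralDensity.aemeasurable_ofReal (hs : IsSpectralDensity s) :
    AEMeasurable (fun x => ENNReal.ofReal (s x)) circ :=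
  hs.1.1.aemeasurable.ennreal_ofReal

theorem IsSpectralDensity.isFiniteMeasure (hs : IsSpectralDensity s) : IsFiniteMeasure (spec s) :=
  isFiniteMeasure_withDensity_ofReal hs.1.2

theorem spec_absolutelyContinuous (s : ℝ → ℝ) : spec s ≪ circ :=
  withDensity_absolutelyContinuous _ _

theorem absolutelyContinuous_spec (hs : IsSpectralDensity s) (hpos : ∀ᵐ x ∂circ, 0 < s x) :
    circ ≪ spec s := by
  refine withDensity_absolutelyContinuous' hs.aemeasurable_ofReal ?_
  filter_upwards [hpos] with x hx
  simpa using hx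

theorem spec_add (hf : IsSpectralDensity f) (hg : IsSpectralDensity g) :
    spec (fun x => f x + g x) = spec f + spec g := by
  unfold spec
  -- Additivity of `withDensity` asks for a measurable summand, while f is only a.e. measurable; its
  -- measurable representative is used.
  have h1 : (fun x => ENNReal.ofReal (f x + g x)) =ᵐ[circ]
      hf.aemeasurable_ofReal.mk _ + fun x => ENNReal.ofReal (g x) := by
    filter_upwards [hf.2, hg.2, hf.aemeasurable_ofReal.ae_eq_mk] with x h1 h2 h3
    rw [ENNReal.ofReal_add h1 h2, h3]; rfl
  rw [withDensity_congr_ae h1, withDensity_add_left hf.aemeasurable_ofReal.measurable_mk,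
    withDensity_congr_ae hf.aemeasurable_ofReal.ae_eq_mk]

theorem spec_const_mul {t : ℝ} (ht : 0 ≤ t) (f : ℝ → ℝ) :
    spec (fun x => t * f x) = ENNReal.ofReal t • spec f := by
  unfold spec
  rw [← withDensity_smul' _ _ ENNReal.ofReal_ne_top]
  congr 1
  funext x
  rw [ENNReal.ofReal_mul ht]; rfl

theorem lintegral_spec (hs : IsSpectralDensity s) {Φ : ℝ → ℝ≥0∞} (hΦ : AEMeasurable Φ (spec s)) :
    ∫⁻ x, Φ x ∂(spec s) = ∫⁻ x, ENNReal.ofReal (s x) * Φ x ∂circ :=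
  lintegral_withDensity_eq_lintegral_mul₀' hs.aemeasurable_ofReal hΦ

theorem integral_spec (hs : IsSpectralDensity s) (F : ℝ → ℂ) :
    ∫ x, F x ∂(spec s) = ∫ x, (s x : ℂ) * F x ∂circ := by
  unfold spec
  rw [integral_withDensity_eq_integral_toReal_smul₀ hs.aemeasurable_ofReal
    (Eventually.of_forall fun x => ENNReal.ofReal_lt_top)]
  refine integral_congr_ae ?_
  filter_upwards [hs.2] with x hx
  rw [ENNReal.toReal_ofReal hx, Complex.real_smul]

theorem integrable_spec_iff (hs : IsSpectralDensity s) (F : ℝ → ℂ) :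
    Integrable F (spec s) ↔ Integrable (fun x => (s x : ℂ) * F x) circ := by
  unfold spec
  rw [integrable_withDensity_iff_integrable_smul₀' hs.aemeasurable_ofReal
    (Eventually.of_forall fun x => ENNReal.ofReal_lt_top)]
  refine integrable_congr ?_
  filter_upwards [hs.2] with x hx
  rw [ENNReal.toReal_ofReal hx, Complex.real_smul]

/-! ### The symbol of the functional -/

theorem norm_mul_expo (z : ℂ) (n : ℤ) (x : ℝ) : ‖z * expo n x‖ = ‖z‖ := by
  rw [norm_mul, norm_expo, mul_one]

theorem continuous_symbolA (ha : Summable fun k => ‖a k‖) : Continuous (symbolA a) :=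
  continuous_tsum (fun _ => continuous_const.mul (continuous_expo _)) ha
    fun _ _ => (norm_mul_expo _ _ _).le

theorem norm_symbolA_le (ha : Summable fun k => ‖a k‖) (x : ℝ) :
    ‖symbolA a x‖ ≤ ∑' k, ‖a k‖ :=
  tsum_of_norm_bounded ha.hasSum fun _ => (norm_mul_expo _ _ _).le

/-- The spectral characteristic `A f / (f + g)` of the optimal estimate based on all `ξ + η`. -/
def twoSidedChar (a : ℕ → ℂ) (f g : ℝ → ℝ) (x : ℝ) : ℂ :=
  symbolA a x * ((f x / (f x + g x) : ℝ) : ℂ)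

/-- The mean-square error `⟨|A|² f g / (f + g)⟩` of the optimal estimate based on all `ξ + η`. -/
def twoSidedErr (a : ℕ → ℂ) (f g : ℝ → ℝ) : ℝ≥0∞ :=
  ∫⁻ x, ENNReal.ofReal (‖symbolA a x‖ ^ 2 * (f x * g x / (f x + g x))) ∂circ

theorem aestronglyMeasurable_ratio (hf : IsSpectralDensity f) (hg : IsSpectralDensity g) :
    AEStronglyMeasurable (fun x => ((f x / (f x + g x) : ℝ) : ℂ)) circ :=
  Complex.continuous_ofReal.comp_aestronglyMeasurable
    (hf.1.1.aemeasurable.div (hf.1.1.aemeasurable.add hg.1.1.aemeasurable)).aestronglyMeasurable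

theorem norm_ratio_le_one (hf : IsSpectralDensity f) (hg : IsSpectralDensity g) :
    ∀ᵐ x ∂circ, ‖((f x / (f x + g x) : ℝ) : ℂ)‖ ≤ 1 := by
  filter_upwards [hf.2, hg.2] with x h1 h2
  rw [Complex.norm_real, Real.norm_of_nonneg (div_nonneg h1 (add_nonneg h1 h2))]
  exact div_le_one_of_le₀ (le_add_of_nonneg_right h2) (add_nonneg h1 h2)

theorem aestronglyMeasurable_twoSidedChar (ha : Summable fun k => ‖a k‖)
    (hf : IsSpectralDensity f) (hg : IsSpectralDensity g) :
    AEStronglyMeasurable (twoSidedChar a f g) circ :=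
  (continuous_symbolA ha).aestronglyMeasurable.mul (aestronglyMeasurable_ratio hf hg)

theorem norm_twoSidedChar_le (ha : Summable fun k => ‖a k‖)
    (hf : IsSpectralDensity f) (hg : IsSpectralDensity g) :
    ∀ᵐ x ∂circ, ‖twoSidedChar a f g x‖ ≤ ∑' k, ‖a k‖ := by
  filter_upwards [norm_ratio_le_one hf hg] with x hx
  rw [twoSidedChar, norm_mul]
  calc _ ≤ (∑' k, ‖a k‖) * 1 := mul_le_mul (norm_symbolA_le ha x) hx (norm_nonneg _)
        (tsum_nonneg fun _ => norm_nonneg _)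
    _ = _ := mul_one _

theorem integrable_twoSidedChar (ha : Summable fun k => ‖a k‖)
    (hf : IsSpectralDensity f) (hg : IsSpectralDensity g) :
    Integrable (twoSidedChar a f g) circ :=
  Integrable.of_bound (aestronglyMeasurable_twoSidedChar ha hf hg) _ (norm_twoSidedChar_le ha hf hg)

theorem memLp_twoSidedChar (ha : Summable fun k => ‖a k‖)
    (hf : IsSpectralDensity f) (hg : IsSpectralDensity g) :
    MemLp (twoSidedChar a f g) 2 (spec fun x => f x + g x) := by
  have := (hf.add hg).isFiniteMeasure
  exact MemLp.of_bound ((aestronglyMeasurable_twoSidedChar ha hf hg).mono_ac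
    (spec_absolutelyContinuous _)) _
    ((spec_absolutelyContinuous _).ae_le (norm_twoSidedChar_le ha hf hg))

theorem harmonic_nonneg_le {p q : ℝ} (hp : 0 ≤ p) (hq : 0 ≤ q) :
    0 ≤ p * q / (p + q) ∧ p * q / (p + q) ≤ p := by
  refine ⟨by positivity, ?_⟩
  rw [mul_div_assoc]
  exact mul_le_of_le_one_right hp (div_le_one_of_le₀ (by linarith) (by linarith))

theorem integrable_harmonic (hf : IsSpectralDensity f) (hg : IsSpectralDensity g) :
    Integrable (fun x => f x * g x / (f x + g x)) circ := by
  refine hf.1.mono' (((hf.1.1.aemeasurable.mul hg.1.1.aemeasurable).div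
    (hf.1.1.aemeasurable.add hg.1.1.aemeasurable)).aestronglyMeasurable) ?_
  filter_upwards [hf.2, hg.2] with x h1 h2
  rw [Real.norm_of_nonneg (harmonic_nonneg_le h1 h2).1]
  exact (harmonic_nonneg_le h1 h2).2

theorem integrable_twoSidedErr (ha : Summable fun k => ‖a k‖)
    (hf : IsSpectralDensity f) (hg : IsSpectralDensity g) :
    Integrable (fun x => ‖symbolA a x‖ ^ 2 * (f x * g x / (f x + g x))) circ := by
  refine (integrable_harmonic hf hg).bdd_mul (c := (∑' k, ‖a k‖) ^ 2)
    ((continuous_symbolA ha).norm.pow 2).aestronglyMeasurable (Eventually.of_forall fun x => ?_)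
  rw [Real.norm_of_nonneg (by positivity)]
  exact pow_le_pow_left₀ (norm_nonneg _) (norm_symbolA_le ha x) 2

theorem twoSidedErr_eq (ha : Summable fun k => ‖a k‖)
    (hf : IsSpectralDensity f) (hg : IsSpectralDensity g) :
    twoSidedErr a f g =
      ENNReal.ofReal (∫ x, ‖symbolA a x‖ ^ 2 * (f x * g x / (f x + g x)) ∂circ) := by
  rw [ofReal_integral_eq_lintegral_ofReal (integrable_twoSidedErr ha hf hg)]
  · rfl
  · filter_upwards [hf.2, hg.2] with x h1 h2
    exact mul_nonneg (by positivity) (harmonic_nonneg_le h1 h2).1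

/-! ### The mean-square error and the optimal characteristic -/

/-- Completion of the square in z: the minimiser is A p/(p+q) and the minimum |A|² p q/(p+q). If p +
q = 0, both sides are 0 because division by 0 gives 0. -/
theorem norm_sq_decomposition (A z : ℂ) {p q : ℝ} (hp : 0 ≤ p) (hq : 0 ≤ q) :
    p * ‖A - z‖ ^ 2 + q * ‖z‖ ^ 2 =
      (p + q) * ‖A * ((p / (p + q) : ℝ) : ℂ) - z‖ ^ 2 + ‖A‖ ^ 2 * (p * q / (p + q)) := by
  rcases eq_or_ne (p + q) 0 with h0 | h0
  · have h1 : p = 0 := by linarith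
    have h2 : q = 0 := by linarith
    simp [h1, h2]
  · simp only [← Complex.normSq_eq_norm_sq, Complex.normSq_apply, Complex.sub_re, Complex.sub_im,
      Complex.re_mul_ofReal, Complex.im_mul_ofReal]
    field_simp
    ring

theorem enorm_sq_eq_ofReal (z : ℂ) : ‖z‖ₑ ^ 2 = ENNReal.ofReal (‖z‖ ^ 2) := by
  rw [ENNReal.ofReal_pow (norm_nonneg _), ofReal_norm]

theorem mse_congr (hf : IsSpectralDensity f) (hg : IsSpectralDensity g)
    (hh : h =ᵐ[spec fun x => f x + g x] h') : mse a h f g = mse a h' f g := by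
  rw [spec_add hf hg, Filter.EventuallyEq, ae_add_measure_iff] at hh
  unfold mse
  congr 1
  · refine lintegral_congr_ae ?_
    filter_upwards [hh.1] with x hx
    rw [hx]
  · refine lintegral_congr_ae ?_
    filter_upwards [hh.2] with x hx
    rw [hx]

/-- The square is completed under the integral. The second summand does not involve h, so minimising
the error means projecting `twoSidedChar` in L₂(f+g). -/
theorem mse_eq (ha : Summable fun k => ‖a k‖) (hf : IsSpectralDensity f)
    (hg : IsSpectralDensity g) (hh : AEStronglyMeasurable h (spec fun x => f x + g x)) :
    mse a h f g = eLpNorm (fun x => twoSidedChar a f g x - h x) 2 (spec fun x => f x + g x) ^ 2 +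
      twoSidedErr a f g := by
  have hm := hh.stronglyMeasurable_mk.measurable
  have hX := aestronglyMeasurable_twoSidedChar ha hf hg
  have hA := (continuous_symbolA ha).measurable
  -- Measurability of h is known only for the spectral measure, which may ignore sets of positive
  -- Lebesgue measure; a measurable representative is needed before passing to integrals over
  -- `circ`.
  rw [mse_congr hf hg hh.ae_eq_mk, ← lintegral_enorm_sq]
  have e1 : ∫⁻ x, ‖twoSidedChar a f g x - h x‖ₑ ^ 2 ∂(spec fun x => f x + g x) =
      ∫⁻ x, ‖twoSidedChar a f g x - hh.mk h x‖ₑ ^ 2 ∂(spec fun x => f x + g x) := by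
    refine lintegral_congr_ae ?_
    filter_upwards [hh.ae_eq_mk] with x hx
    rw [hx]
  have m1 : Measurable fun x => ‖symbolA a x - hh.mk h x‖ₑ ^ 2 := (hA.sub hm).enorm.pow_const 2
  have m2 : Measurable fun x => ‖hh.mk h x‖ₑ ^ 2 := hm.enorm.pow_const 2
  have m3 : AEMeasurable (fun x => ‖twoSidedChar a f g x - hh.mk h x‖ₑ ^ 2) circ :=
    (hX.sub hm.aestronglyMeasurable).enorm.pow_const 2
  have n1 : AEMeasurable (fun x => ENNReal.ofReal (f x) * ‖symbolA a x - hh.mk h x‖ₑ ^ 2) circ :=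
    hf.aemeasurable_ofReal.mul m1.aemeasurable
  have n3 : AEMeasurable (fun x => ENNReal.ofReal (f x + g x) *
      ‖twoSidedChar a f g x - hh.mk h x‖ₑ ^ 2) circ := (hf.add hg).aemeasurable_ofReal.mul m3
  rw [e1, mse, lintegral_spec hf m1.aemeasurable, lintegral_spec hg m2.aemeasurable,
    lintegral_spec (hf.add hg) (m3.mono_ac (spec_absolutelyContinuous _)), twoSidedErr,
    ← lintegral_add_left' n1, ← lintegral_add_left' n3]
  refine lintegral_congr_ae ?_
  filter_upwards [hf.2, hg.2] with x h1 h2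
  rw [enorm_sq_eq_ofReal, enorm_sq_eq_ofReal, enorm_sq_eq_ofReal,
    ← ENNReal.ofReal_mul h1, ← ENNReal.ofReal_mul h2, ← ENNReal.ofReal_mul (add_nonneg h1 h2),
    ← ENNReal.ofReal_add (by positivity) (by positivity), ← ENNReal.ofReal_add (by positivity)
      (mul_nonneg (by positivity) (harmonic_nonneg_le h1 h2).1), norm_sq_decomposition _ _ h1 h2]
  rfl

/-- `h` is the orthogonal projection of `A f / (f + g)` to the past in `L₂(f + g)`. -/
def IsProjection (a : ℕ → ℂ) (f g : ℝ → ℝ) (h : ℝ → ℂ) : Prop :=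
  MemPast (fun x => f x + g x) h ∧
    ∀ k : ℕ, ∫ x, (twoSidedChar a f g x - h x) * conj (expo (-(k : ℤ)) x)
      ∂(spec fun x => f x + g x) = 0

theorem exists_isProjection (ha : Summable fun k => ‖a k‖) (hf : IsSpectralDensity f)
    (hg : IsSpectralDensity g) : ∃ h, IsProjection a f g h := by
  have := (hf.add hg).isFiniteMeasure
  -- `MemPast` unfolds to `InClosedSpan` for the exponentials e^{-ikλ}, as `pastPoly` does to
  -- `lincomb`.
  exact exists_projection (fun k : ℕ => memLp_expo (-(k : ℤ))) (memLp_twoSidedChar ha hf hg)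

/-- Pythagoras gives the exact loss of a competing characteristic. Beyond optimality, it forces
near-optimal characteristics to be close to h, which the saddle point argument exploits. -/
theorem IsProjection.mse_eq_add (ha : Summable fun k => ‖a k‖) (hf : IsSpectralDensity f)
    (hg : IsSpectralDensity g) (hh : IsProjection a f g h)
    (hh' : MemPast (fun x => f x + g x) h') :
    mse a h' f g = mse a h f g + eLpNorm (fun x => h x - h' x) 2 (spec fun x => f x + g x) ^ 2 := by
  have := (hf.add hg).isFiniteMeasure
  rw [mse_eq ha hf hg hh'.1.1, mse_eq ha hf hg hh.1.1.1, eLpNorm_sub_sq_of_projection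
    (fun k : ℕ => memLp_expo (-(k : ℤ))) (memLp_twoSidedChar ha hf hg) hh.1 hh.2 hh']
  ring

theorem IsProjection.isOptimalChar (ha : Summable fun k => ‖a k‖) (hf : IsSpectralDensity f)
    (hg : IsSpectralDensity g) (hh : IsProjection a f g h) : IsOptimalChar a f g h := by
  refine ⟨hh.1, le_antisymm (le_iInf₂ fun h' hh' => ?_) (iInf₂_le h hh.1)⟩
  rw [hh.mse_eq_add ha hf hg hh']
  exact le_self_add

theorem mse_ne_top (ha : Summable fun k => ‖a k‖) (hf : IsSpectralDensity f)
    (hg : IsSpectralDensity g) (hh : MemLp h 2 (spec fun x => f x + g x)) :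
    mse a h f g ≠ ∞ := by
  rw [mse_eq ha hf hg hh.1, twoSidedErr_eq ha hf hg]
  exact ENNReal.add_ne_top.2 ⟨ENNReal.pow_ne_top
    ((memLp_twoSidedChar ha hf hg).sub hh).eLpNorm_ne_top, ENNReal.ofReal_ne_top⟩

end SpectralMeasure

section Operators

variable {a : ℕ → ℂ} {f g s : ℝ → ℝ} {h : ℝ → ℂ}

/-! ### The operators as Fourier coefficients -/

theorem integral_symbolA_mul (ha : Summable fun k => ‖a k‖) {G : ℝ → ℂ} (hG : Integrable G circ) :
    ∫ x, symbolA a x * G x ∂circ = ∑' k : ℕ, a k * ∫ x, expo (-(k : ℤ)) x * G x ∂circ := by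
  have h1 : ∀ k : ℕ, Integrable (fun x => a k * (expo (-(k : ℤ)) x * G x)) circ :=
    fun k => (integrable_expo_mul hG _).const_mul _
  have h2 : Summable fun k : ℕ => ∫ x, ‖a k * (expo (-(k : ℤ)) x * G x)‖ ∂circ := by
    simp_rw [norm_mul, norm_expo, one_mul, integral_const_mul]
    exact ha.mul_right _
  simp_rw [← integral_const_mul]
  rw [integral_tsum_of_summable_integral_norm h1 h2]
  refine integral_congr_ae (Eventually.of_forall fun x => ?_)
  simp only [symbolA]
  rw [← tsum_mul_right]
  simp_rw [mul_assoc]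

/-- R a records exactly the coefficients that keep A f/(f+g) from being a series in nonpositive
frequencies. -/
theorem coeff_twoSidedChar (ha : Summable fun k => ‖a k‖) (hf : IsSpectralDensity f)
    (hg : IsSpectralDensity g) (l : ℕ) :
    coeff (twoSidedChar a f g) ((l : ℤ) + 1) = vecRa a f g l := by
  have hr : Integrable (fun x => ((f x / (f x + g x) : ℝ) : ℂ)) circ :=
    Integrable.of_bound (aestronglyMeasurable_ratio hf hg) 1 (norm_ratio_le_one hf hg)
  have h1 : coeff (twoSidedChar a f g) ((l : ℤ) + 1) = ∫ x, symbolA a x *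
      (expo (-((l : ℤ) + 1)) x * ((f x / (f x + g x) : ℝ) : ℂ)) ∂circ := by
    unfold coeff twoSidedChar
    congr 1; ext x; ring
  rw [h1, integral_symbolA_mul ha (integrable_expo_mul hr _), vecRa]
  refine tsum_congr fun m => ?_
  rw [mul_comm, matR]
  congr 2
  ext x
  rw [← mul_assoc, expo_mul]
  congr 2
  push_cast; ring

theorem integral_symbolA_mul_conj (ha : Summable fun k => ‖a k‖) {G : ℝ → ℂ}
    (hG : Integrable G circ) :
    ∫ x, conj (symbolA a x) * G x ∂circ =
      ∑' k : ℕ, conj (a k) * ∫ x, expo (k : ℤ) x * G x ∂circ := by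
  have h1 := congrArg conj (integral_symbolA_mul ha (integrable_conj hG))
  rw [← integral_conj, Complex.conj_tsum] at h1
  simp only [map_mul, Complex.conj_conj, ← integral_conj, conj_expo, neg_neg] at h1
  exact h1

/-- The inner sums are the Fourier coefficients of A f g/(f+g) at -l; the outer sum reassembles conj
A against that function. Thus ⟨Q a, a⟩ is the two-sided error. -/
theorem formQ_eq (ha : Summable fun k => ‖a k‖) (hf : IsSpectralDensity f)
    (hg : IsSpectralDensity g) : formQ a f g =
      ((∫ x, ‖symbolA a x‖ ^ 2 * (f x * g x / (f x + g x)) ∂circ : ℝ) : ℂ) := by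
  have hq : Integrable (fun x => ((f x * g x / (f x + g x) : ℝ) : ℂ)) circ :=
    (integrable_harmonic hf hg).ofReal
  have hAq : Integrable (fun x => symbolA a x * ((f x * g x / (f x + g x) : ℝ) : ℂ)) circ :=
    hq.bdd_mul (continuous_symbolA ha).aestronglyMeasurable
      (Eventually.of_forall fun x => norm_symbolA_le ha x)
  have h1 : ∀ l : ℕ, ∑' k : ℕ, matQ f g l k * a k =
      ∫ x, expo (l : ℤ) x * (symbolA a x * ((f x * g x / (f x + g x) : ℝ) : ℂ)) ∂circ := by
    intro l
    have h2 := integral_symbolA_mul ha (integrable_expo_mul hq (l : ℤ))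
    have h3 : ∫ x, expo (l : ℤ) x * (symbolA a x * ((f x * g x / (f x + g x) : ℝ) : ℂ)) ∂circ =
        ∫ x, symbolA a x * (expo (l : ℤ) x * ((f x * g x / (f x + g x) : ℝ) : ℂ)) ∂circ := by
      congr 1; ext x; ring
    rw [h3, h2]
    refine tsum_congr fun k => ?_
    rw [mul_comm, matQ]
    congr 2
    ext x
    rw [← mul_assoc, expo_mul]
    congr 2
    ring
  unfold formQ
  simp_rw [h1, mul_comm _ (conj _)]
  rw [← integral_symbolA_mul_conj ha hAq, ← integral_complex_ofReal]
  congr 1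
  ext x
  rw [← mul_assoc, Complex.conj_mul']
  push_cast
  ring

/-! ### Consequences of the minimality condition -/

/-- The squared norm is ⟨1/(f+g)⟩, so this is the minimality condition in L₂ form. Pairing with
these functions in L₂(f+g) computes ordinary Fourier coefficients. -/
theorem memLp_expo_div (hf : IsSpectralDensity f) (hg : IsSpectralDensity g)
    (hm : Minimality f g) (n : ℤ) :
    MemLp (fun x => expo n x * ((1 / (f x + g x) : ℝ) : ℂ)) 2 (spec fun x => f x + g x) := by
  have hmeas : AEStronglyMeasurable (fun x => expo n x * ((1 / (f x + g x) : ℝ) : ℂ)) circ :=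
    (continuous_expo n).aestronglyMeasurable.mul
      (Complex.continuous_ofReal.comp_aestronglyMeasurable hm.2.1)
  have hmeas' := hmeas.mono_ac (spec_absolutelyContinuous fun x => f x + g x)
  refine ⟨hmeas', ?_⟩
  have h2 : eLpNorm (fun x => expo n x * ((1 / (f x + g x) : ℝ) : ℂ)) 2
      (spec fun x => f x + g x) ^ 2 < ∞ := by
    rw [← lintegral_enorm_sq, lintegral_spec (hf.add hg) (hmeas'.enorm.pow_const 2)]
    refine lt_of_eq_of_lt (lintegral_congr_ae ?_) hm.2.lintegral_lt_top
    filter_upwards [hm.1] with x hx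
    rw [enorm_sq_eq_ofReal, ← ENNReal.ofReal_mul hx.le, norm_mul, norm_expo, one_mul,
      Complex.norm_real, Real.norm_of_nonneg (by positivity)]
    congr 1
    field_simp
  exact (ENNReal.pow_lt_top_iff.1 h2).resolve_right (by norm_num)

theorem integrable_of_memLp_spec (hf : IsSpectralDensity f) (hg : IsSpectralDensity g)
    (hm : Minimality f g) (hh : MemLp h 2 (spec fun x => f x + g x)) : Integrable h circ := by
  have h1 := MemLp.integrable_mul hh (memLp_expo_div hf hg hm 0)
  rw [integrable_spec_iff (hf.add hg)] at h1
  refine h1.congr ?_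
  filter_upwards [hm.1] with x hx
  have hx' : ((f x + g x : ℝ) : ℂ) ≠ 0 := by exact_mod_cast hx.ne'
  simp only [Pi.mul_apply, expo_zero, one_mul]
  push_cast at hx' ⊢
  field_simp

/-- Up to conjugation the coefficient is the inner product in L₂(f+g) with e^{i(l+1)λ}/(f+g), which
is orthogonal to every e^{-ikλ}, k ≥ 0, hence to their closed span. -/
theorem MemPast.coeff_eq_zero (hf : IsSpectralDensity f) (hg : IsSpectralDensity g)
    (hm : Minimality f g) (hh : MemPast (fun x => f x + g x) h) (l : ℕ) :
    coeff h ((l : ℤ) + 1) = 0 := by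
  have := (hf.add hg).isFiniteMeasure
  have hpt : ∀ (F : ℝ → ℂ), ∫ x, expo ((l : ℤ) + 1) x * ((1 / (f x + g x) : ℝ) : ℂ) * F x
      ∂(spec fun x => f x + g x) = ∫ x, expo ((l : ℤ) + 1) x * F x ∂circ := by
    intro F
    rw [integral_spec (hf.add hg)]
    refine integral_congr_ae ?_
    filter_upwards [hm.1] with x hx
    have hx' : ((f x + g x : ℝ) : ℂ) ≠ 0 := by exact_mod_cast hx.ne'
    push_cast at hx' ⊢
    field_simp
  have h1 := InClosedSpan.integral_mul_conj_eq_zero (fun k : ℕ => memLp_expo (-(k : ℤ)))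
    (memLp_expo_div hf hg hm ((l : ℤ) + 1)) (fun k => by
      rw [hpt]
      simp_rw [conj_expo, expo_mul]
      rw [integral_expo, if_neg (by omega)]) hh
  rw [hpt] at h1
  have h2 := congrArg conj h1
  rw [← integral_conj, map_zero] at h2
  simp only [map_mul, Complex.conj_conj, conj_expo] at h2
  exact h2

/-! ### The objective of the optimization problem -/

theorem twoSidedChar_sub_charH (a : ℕ → ℂ) (f g : ℝ → ℝ) (C : ℝ → ℂ) (x : ℝ) :
    twoSidedChar a f g x - charH a f g C x = C x / ((f x + g x : ℝ) : ℂ) := by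
  unfold twoSidedChar charH; ring

/-- Minimality alone makes P c = R a solvable in the form domain: with h the projection of X, take C
= (f+g)(X - h). Orthogonality removes the nonpositive coefficients of C, h being in the past is the
equation, and the energy is ‖X - h‖². This supplies a solution for every competing mixture in the
maximum problem. -/
theorem exists_isPInvRa (ha : Summable fun k => ‖a k‖) (hf : IsSpectralDensity f)
    (hg : IsSpectralDensity g) (hm : Minimality f g) : ∃ (c : ℕ → ℂ) (C : ℝ → ℂ),
      IsPInvRa a f g c C ∧ IsProjection a f g (charH a f g C) := by
  have := (hf.add hg).isFiniteMeasure
  obtain ⟨h, hh⟩ := exists_isProjection ha hf hg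
  let D : ℝ → ℂ := fun x => twoSidedChar a f g x - h x
  let C : ℝ → ℂ := fun x => ((f x + g x : ℝ) : ℂ) * D x
  have hD : MemLp D 2 (spec fun x => f x + g x) := (memLp_twoSidedChar ha hf hg).sub hh.1.1
  have hC : Integrable C circ :=
    (integrable_spec_iff (hf.add hg) D).1 (hD.integrable (by norm_num))
  have hCD : ∀ᵐ x ∂circ, C x / ((f x + g x : ℝ) : ℂ) = D x := by
    filter_upwards [hm.1] with x hx
    have hx' : ((f x + g x : ℝ) : ℂ) ≠ 0 := by exact_mod_cast hx.ne'
    exact mul_div_cancel_left₀ _ hx'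
  have hchar : charH a f g C =ᵐ[spec fun x => f x + g x] h := by
    refine (spec_absolutelyContinuous _).ae_le ?_
    filter_upwards [hCD] with x hx
    have := twoSidedChar_sub_charH a f g C x
    rw [hx] at this
    exact sub_right_injective this
  refine ⟨fun k => coeff C ((k : ℤ) + 1), C, ⟨⟨hC, fun k => rfl, fun k => ?_⟩, ?_, fun l => ?_⟩,
    ⟨⟨hh.1.1.ae_eq hchar.symm, fun δ hδ => ?_⟩, fun k => ?_⟩⟩
  · rw [← hh.2 k, integral_spec (hf.add hg)]
    unfold coeff
    congr 1; ext x
    simp only [conj_expo, C, D]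
    ring
  · have h2 : eLpNorm D 2 (spec fun x => f x + g x) ^ 2 < ∞ :=
      ENNReal.pow_lt_top hD.eLpNorm_lt_top
    rw [← lintegral_enorm_sq, lintegral_spec (hf.add hg) (hD.1.enorm.pow_const 2)] at h2
    refine lt_of_eq_of_lt (lintegral_congr_ae ?_) h2
    filter_upwards [hm.1] with x hx
    rw [enorm_sq_eq_ofReal, enorm_sq_eq_ofReal, ← ENNReal.ofReal_mul hx.le,
      ← ENNReal.ofReal_mul (by positivity)]
    congr 1
    simp only [C, norm_mul, Complex.norm_real, Real.norm_of_nonneg hx.le]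
    field_simp
  · unfold applyP
    rw [coeff_congr hCD, coeff_sub (integrable_twoSidedChar ha hf hg)
      (integrable_of_memLp_spec hf hg hm hh.1.1), coeff_twoSidedChar ha hf hg,
      hh.1.coeff_eq_zero hf hg hm, sub_zero]
  · obtain ⟨b, hb⟩ := hh.1.2 δ hδ
    refine ⟨b, lt_of_eq_of_lt (eLpNorm_congr_ae ?_) hb⟩
    filter_upwards [hchar] with x hx
    rw [hx]
  · rw [← hh.2 k]
    refine integral_congr_ae ?_
    filter_upwards [hchar] with x hx
    rw [hx]

theorem integral_mul_conj_self {α : Type*} [MeasurableSpace α] {ν : Measure α} {D : α → ℂ}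
    (hD : MemLp D 2 ν) : ∫ x, D x * conj (D x) ∂ν = (((eLpNorm D 2 ν ^ 2).toReal : ℝ) : ℂ) := by
  rw [← inner_toLp_eq hD hD, inner_self_eq_norm_sq_to_K, Lp.norm_toLp, ENNReal.toReal_pow]
  simp

/-- Summation by means gives ⟨R a, c⟩ = ⟨X conj C⟩ because X is bounded. This is the inner product
of X with D = X - h in L₂(f+g), and equals ‖D‖² since h ⟂ D. Adding ⟨Q a, a⟩ yields the optimal
error. -/
theorem IsPInvRa.hasObjective {c : ℕ → ℂ} {C : ℝ → ℂ} (ha : Summable fun k => ‖a k‖)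
    (hf : IsSpectralDensity f) (hg : IsSpectralDensity g) (hm : Minimality f g)
    (hC : IsPInvRa a f g c C) (hp : IsProjection a f g (charH a f g C)) :
    HasObjective a f g c (mse a (charH a f g C) f g).toReal := by
  have := (hf.add hg).isFiniteMeasure
  let D : ℝ → ℂ := fun x => twoSidedChar a f g x - charH a f g C x
  have hD : MemLp D 2 (spec fun x => f x + g x) := (memLp_twoSidedChar ha hf hg).sub hp.1.1
  have hinner := hasInner_of_bounded (integrable_twoSidedChar ha hf hg)
    (norm_twoSidedChar_le ha hf hg) hC.series.1 hC.series.2.2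
  simp_rw [coeff_twoSidedChar ha hf hg, hC.series.2.1] at hinner
  refine ⟨_, hinner, ?_⟩
  have h1 : ∫ x, twoSidedChar a f g x * conj (C x) ∂circ =
      ∫ x, twoSidedChar a f g x * conj (D x) ∂(spec fun x => f x + g x) := by
    rw [integral_spec (hf.add hg)]
    refine integral_congr_ae ?_
    filter_upwards [hm.1] with x hx
    have hx' : ((f x + g x : ℝ) : ℂ) ≠ 0 := by exact_mod_cast hx.ne'
    simp only [D, twoSidedChar_sub_charH, map_div₀, Complex.conj_ofReal]
    field_simp
  have h2 : ∫ x, D x * conj (charH a f g C x) ∂(spec fun x => f x + g x) = 0 :=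
    InClosedSpan.integral_mul_conj_eq_zero (fun k : ℕ => memLp_expo (-(k : ℤ))) hD hp.2 hp.1
  have h3 : ∫ x, charH a f g C x * conj (D x) ∂(spec fun x => f x + g x) = 0 := by
    have h4 := congrArg conj h2
    rw [← integral_conj, map_zero] at h4
    simpa only [map_mul, Complex.conj_conj, mul_comm] using h4
  have h5 : ∫ x, twoSidedChar a f g x * conj (D x) ∂(spec fun x => f x + g x) =
      ∫ x, D x * conj (D x) ∂(spec fun x => f x + g x) := by
    rw [← add_zero (∫ x, D x * conj (D x) ∂_), ← h3, ← integral_add (integrable_mul_conj hD hD)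
      (integrable_mul_conj hp.1.1 hD)]
    congr 1; ext x
    simp only [D]; ring
  rw [h1, h5, integral_mul_conj_self hD, formQ_eq ha hf hg, mse_eq ha hf hg hp.1.1.1,
    twoSidedErr_eq ha hf hg, ENNReal.toReal_add (ENNReal.pow_ne_top hD.eLpNorm_ne_top)
      ENNReal.ofReal_ne_top, ENNReal.toReal_ofReal]
  · push_cast; rfl
  · refine integral_nonneg_of_ae ?_
    filter_upwards [hf.2, hg.2] with x h1 h2
    exact mul_nonneg (by positivity) (harmonic_nonneg_le h1 h2).1

theorem HasObjective.unique {c : ℕ → ℂ} {v w : ℝ} (hv : HasObjective a f g c v)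
    (hw : HasObjective a f g c w) : v = w := by
  obtain ⟨p, hp, hvp⟩ := hv
  obtain ⟨q, hq, hwq⟩ := hw
  have := tendsto_nhds_unique hp hq
  rw [this, ← hwq] at hvp
  exact_mod_cast hvp

/-! ### Bounded causal characteristics -/

/-- The terms with p > q carry positive indices and vanish; the others are multiples of
e^{-i(q-p)x}. -/
theorem exists_fejer_eq_pastPoly (hh : ∀ l : ℕ, coeff h ((l : ℤ) + 1) = 0) (n : ℕ) :
    ∃ b : ℕ →₀ ℂ, fejer n h = pastPoly b := by
  refine ⟨(1 / (n : ℂ)) • ∑ p ∈ Finset.range n, ∑ q ∈ Finset.range n,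
    if p ≤ q then Finsupp.single (q - p) (coeff h ((p : ℤ) - q)) else 0, ?_⟩
  funext x
  change _ = lincomb (fun k : ℕ => expo (-(k : ℤ))) _ x
  rw [lincomb_smul, lincomb_sum, fejer]
  congr 1
  refine Finset.sum_congr rfl fun p _ => ?_
  rw [lincomb_sum]
  refine Finset.sum_congr rfl fun q _ => ?_
  split_ifs with hpq
  · rw [lincomb_single, show (p : ℤ) - q = -((q - p : ℕ) : ℤ) by omega]
  · rw [lincomb_zero, show (p : ℤ) - q = ((p - q - 1 : ℕ) : ℤ) + 1 by omega, hh, zero_mul]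

/-- A bounded function without coefficients of positive index lies in every `L₂⁰(s)`. -/
theorem memPast_of_bounded {K : ℝ} (hi : Integrable h circ) (hK : ∀ᵐ x ∂circ, ‖h x‖ ≤ K)
    (hh : ∀ l : ℕ, coeff h ((l : ℤ) + 1) = 0) (hs : IsSpectralDensity s) : MemPast s h := by
  have := hs.isFiniteMeasure
  have hac := spec_absolutelyContinuous s
  choose b hb using exists_fejer_eq_pastPoly hh
  have hL : Tendsto (fun n => eLpNorm (fejer n h - h) 1 circ) atTop (𝓝 0) := by
    simp_rw [eLpNorm_one_eq_lintegral_enorm]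
    exact fejerTendsto hi
  -- L¹ convergence gives a.e. convergence along a subsequence. The means inherit the bound of h and
  -- `spec s` is finite, so dominated convergence gives L₂(s) whatever s is.
  obtain ⟨ns, -, hns⟩ := (tendstoInMeasure_of_tendsto_eLpNorm one_ne_zero
    (fun n => (continuous_fejer n h).aestronglyMeasurable) hi.1 hL).exists_seq_tendsto_ae
  have hK0 : ∀ᵐ x ∂circ, ‖h x‖ ≤ max K 0 := hK.mono fun x hx => hx.trans (le_max_left _ _)
  have hmem : MemLp h 2 (spec s) := MemLp.of_bound (hi.1.mono_ac hac) _ (hac.ae_le hK)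
  have hlim : Tendsto (fun i => ∫⁻ x, ‖h x - fejer (ns i) h x‖ₑ ^ 2 ∂(spec s)) atTop
      (𝓝 (∫⁻ _, 0 ∂(spec s))) := by
    refine tendsto_lintegral_of_dominated_convergence'
      (fun _ => ENNReal.ofReal ((max K 0 + max K 0) ^ 2))
      (fun i => ((hi.1.mono_ac hac).sub (continuous_fejer _ h).aestronglyMeasurable).enorm.pow_const
        2) (fun i => ?_) ?_ ?_
    · filter_upwards [hac.ae_le hK0] with x hx
      rw [enorm_sq_eq_ofReal]
      refine ENNReal.ofReal_le_ofReal (pow_le_pow_left₀ (norm_nonneg _) ?_ 2)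
      exact (norm_sub_le _ _).trans
        (add_le_add hx (norm_fejer_le hi (le_max_right _ _) hK0 _ _))
    · rw [lintegral_const]
      exact ENNReal.mul_ne_top ENNReal.ofReal_ne_top (measure_ne_top _ _)
    · filter_upwards [hac.ae_le hns] with x hx
      have h1 : Tendsto (fun i => ‖h x - fejer (ns i) h x‖ₑ ^ 2) atTop (𝓝 (‖h x - h x‖ₑ ^ 2)) :=
        ((ENNReal.continuous_pow 2).tendsto _).comp
          ((continuous_enorm.tendsto _).comp (tendsto_const_nhds.sub hx))
      simpa using h1
  rw [lintegral_zero] at hlim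
  refine ⟨hmem, fun δ hδ => ?_⟩
  obtain ⟨i, hi'⟩ := ((tendsto_order.1 hlim).2 (δ ^ 2) (by positivity)).exists
  refine ⟨b (ns i), ?_⟩
  rw [lintegral_enorm_sq (spec s) (fun x => h x - fejer (ns i) h x), hb (ns i)] at hi'
  exact lt_of_not_ge fun hle => absurd hi' (not_lt.2 (pow_le_pow_left' hle 2))

/-- The modulus of `charH` is h_g, hence bounded, and P c = R a says that its positive coefficients
vanish. The density s is arbitrary, which yields membership in H_D. -/
theorem IsPInvRa.memPast_charH {c : ℕ → ℂ} {C : ℝ → ℂ} {K : ℝ}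
    (ha : Summable fun k => ‖a k‖) (hf : IsSpectralDensity f) (hg' : IsSpectralDensity g)
    (hm : Minimality f g) (hC : IsPInvRa a f g c C) (hK : ∀ᵐ x ∂circ, hg a f g C x ≤ K)
    (hs : IsSpectralDensity s) : MemPast s (charH a f g C) := by
  have hmeas : AEStronglyMeasurable (fun x => C x / ((f x + g x : ℝ) : ℂ)) circ :=
    (hC.series.1.1.aemeasurable.div (Complex.measurable_ofReal.comp_aemeasurable
      (hf.1.1.aemeasurable.add hg'.1.1.aemeasurable))).aestronglyMeasurable
  have hchar : charH a f g C = fun x => twoSidedChar a f g x - C x / ((f x + g x : ℝ) : ℂ) := rfl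
  have hmc : AEStronglyMeasurable (charH a f g C) circ :=
    (aestronglyMeasurable_twoSidedChar ha hf hg').sub hmeas
  have hb : ∀ᵐ x ∂circ, ‖charH a f g C x‖ ≤ K := by
    filter_upwards [hK, hm.1] with x hx hpos
    refine le_of_eq_of_le ?_ hx
    rw [hg, charH, Complex.ofReal_div, ← mul_div_assoc, ← sub_div, norm_div, Complex.norm_real,
      Real.norm_of_nonneg hpos.le]
  have hi : Integrable (charH a f g C) circ := Integrable.of_bound hmc K hb
  have hX := integrable_twoSidedChar ha hf hg'
  have hCs : Integrable (fun x => C x / ((f x + g x : ℝ) : ℂ)) circ := by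
    refine (hX.sub hi).congr (Eventually.of_forall fun x => ?_)
    exact twoSidedChar_sub_charH a f g C x
  refine memPast_of_bounded hi hb (fun l => ?_) hs
  have hsol := hC.solves l
  unfold applyP at hsol
  rw [hchar, coeff_sub hX hCs, coeff_twoSidedChar ha hf hg', hsol, sub_self]

/-- The inner products of X - h = C/(f+g) with e^{-ikλ} in L₂(f+g) are the coefficients of C at -k.
-/
theorem IsPInvRa.isProjection {c : ℕ → ℂ} {C : ℝ → ℂ} (hf : IsSpectralDensity f)
    (hg : IsSpectralDensity g) (hm : Minimality f g) (hC : IsPInvRa a f g c C)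
    (hh : MemPast (fun x => f x + g x) (charH a f g C)) :
    IsProjection a f g (charH a f g C) := by
  refine ⟨hh, fun k => ?_⟩
  rw [← hC.series.2.2 k, integral_spec (hf.add hg)]
  unfold coeff
  refine integral_congr_ae ?_
  filter_upwards [hm.1] with x hx
  have hx' : ((f x + g x : ℝ) : ℂ) ≠ 0 := by exact_mod_cast hx.ne'
  rw [twoSidedChar_sub_charH, conj_expo]
  field_simp

end Operators

section SaddlePoint

variable {a : ℕ → ℂ} {f g f0 g0 : ℝ → ℝ} {h : ℝ → ℂ}

/-! ### Convexity of the classes -/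

theorem IsSpectralDensity.convex (hf0 : IsSpectralDensity f0) (hf : IsSpectralDensity f) {t : ℝ}
    (ht0 : 0 ≤ t) (ht1 : t ≤ 1) : IsSpectralDensity (fun x => (1 - t) * f0 x + t * f x) :=
  (hf0.const_mul (by linarith)).add (hf.const_mul ht0)

theorem integral_convex_le {P t : ℝ} (hf0 : Integrable f0 circ) (hf : Integrable f circ)
    (h0 : ∫ x, f0 x ∂circ ≤ P) (h1 : ∫ x, f x ∂circ ≤ P) (ht0 : 0 ≤ t) (ht1 : t ≤ 1) :
    ∫ x, ((1 - t) * f0 x + t * f x) ∂circ ≤ P := by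
  rw [integral_add (hf0.const_mul _) (hf.const_mul _), integral_const_mul, integral_const_mul]
  nlinarith [mul_le_mul_of_nonneg_left h0 (by linarith : 0 ≤ 1 - t),
    mul_le_mul_of_nonneg_left h1 ht0]

theorem bandClass_convex {v u : ℝ → ℝ} {P t : ℝ} (hf0 : f0 ∈ bandClass v u P)
    (hf : f ∈ bandClass v u P) (ht0 : 0 ≤ t) (ht1 : t ≤ 1) :
    (fun x => (1 - t) * f0 x + t * f x) ∈ bandClass v u P := by
  refine ⟨hf0.1.convex hf.1 ht0 ht1, ?_, integral_convex_le hf0.1.1 hf.1.1 hf0.2.2 hf.2.2 ht0 ht1⟩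
  filter_upwards [hf0.2.1, hf.2.1] with x h0 h1
  have ht : 0 ≤ 1 - t := by linarith
  constructor
  · nlinarith [mul_le_mul_of_nonneg_left h0.1 ht, mul_le_mul_of_nonneg_left h1.1 ht0]
  · nlinarith [mul_le_mul_of_nonneg_left h0.2 ht, mul_le_mul_of_nonneg_left h1.2 ht0]

theorem contamClass_convex {g1 : ℝ → ℝ} {ε P t : ℝ} (hg0 : g0 ∈ contamClass ε g1 P)
    (hg : g ∈ contamClass ε g1 P) (ht0 : 0 ≤ t) (ht1 : t ≤ 1) :
    (fun x => (1 - t) * g0 x + t * g x) ∈ contamClass ε g1 P := by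
  obtain ⟨hd0, ⟨w0, hw0, he0⟩, hP0⟩ := hg0
  obtain ⟨hd, ⟨w, hw, he⟩, hP⟩ := hg
  refine ⟨hd0.convex hd ht0 ht1, ⟨_, hw0.convex hw ht0 ht1, ?_⟩,
    integral_convex_le hd0.1 hd.1 hP0 hP ht0 ht1⟩
  filter_upwards [he0, he] with x h0 h1
  rw [h0, h1]; ring

/-- The mixture dominates (1-t)(f0 + g0). Only the base pair has to be minimal, which is why t = 1
is excluded. -/
theorem Minimality.convex (hf0 : IsSpectralDensity f0) (hg0 : IsSpectralDensity g0)
    (hf : IsSpectralDensity f) (hg : IsSpectralDensity g) (hm : Minimality f0 g0) {t : ℝ}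
    (ht0 : 0 ≤ t) (ht1 : t < 1) :
    Minimality (fun x => (1 - t) * f0 x + t * f x) (fun x => (1 - t) * g0 x + t * g x) := by
  have ht : 0 < 1 - t := by linarith
  have hle : ∀ᵐ x ∂circ, (1 - t) * (f0 x + g0 x) ≤
      (1 - t) * f0 x + t * f x + ((1 - t) * g0 x + t * g x) := by
    filter_upwards [hf.2, hg.2] with x h1 h2
    nlinarith [mul_nonneg ht0 h1, mul_nonneg ht0 h2]
  refine ⟨?_, ?_⟩
  · filter_upwards [hle, hm.1] with x h1 h2
    exact lt_of_lt_of_le (mul_pos ht h2) h1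
  · refine (hm.2.const_mul (1 - t)⁻¹).mono' ?_ ?_
    · exact (aemeasurable_const.div ((hf0.convex hf ht0 ht1.le).add
        (hg0.convex hg ht0 ht1.le)).1.1.aemeasurable).aestronglyMeasurable
    · filter_upwards [hle, hm.1] with x h1 h2
      have h3 := mul_pos ht h2
      rw [Real.norm_of_nonneg (by positivity [h3.trans_le h1]), ← one_div, div_mul_div_comm, one_mul]
      exact one_div_le_one_div_of_le h3 h1

/-! ### The saddle point inequality -/

theorem spec_convex (hf0 : IsSpectralDensity f0) (hf : IsSpectralDensity f) {t : ℝ}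
    (ht0 : 0 ≤ t) (ht1 : t ≤ 1) : spec (fun x => (1 - t) * f0 x + t * f x) =
      ENNReal.ofReal (1 - t) • spec f0 + ENNReal.ofReal t • spec f := by
  rw [spec_add (hf0.const_mul (by linarith)) (hf.const_mul ht0), spec_const_mul (by linarith),
    spec_const_mul ht0]

theorem mse_convex (a : ℕ → ℂ) (h : ℝ → ℂ) (hf0 : IsSpectralDensity f0)
    (hg0 : IsSpectralDensity g0) (hf : IsSpectralDensity f) (hg : IsSpectralDensity g) {t : ℝ}
    (ht0 : 0 ≤ t) (ht1 : t ≤ 1) :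
    mse a h (fun x => (1 - t) * f0 x + t * f x) (fun x => (1 - t) * g0 x + t * g x) =
      ENNReal.ofReal (1 - t) * mse a h f0 g0 + ENNReal.ofReal t * mse a h f g := by
  unfold mse
  rw [spec_convex hf0 hf ht0 ht1, spec_convex hg0 hg ht0 ht1]
  simp only [lintegral_add_measure, lintegral_smul_measure, smul_eq_mul]
  ring

/-- Each component measure is at most 1/(1-t), respectively 1/t, times the mixture, so membership in
the past descends to both. -/
theorem MemPast.of_convex (hf0 : IsSpectralDensity f0) (hg0 : IsSpectralDensity g0)
    (hf : IsSpectralDensity f) (hg : IsSpectralDensity g) {t : ℝ} (ht0 : 0 < t) (ht1 : t < 1)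
    (hh : MemPast (fun x => (1 - t) * f0 x + t * f x + ((1 - t) * g0 x + t * g x)) h) :
    MemPast (fun x => f0 x + g0 x) h ∧ MemPast (fun x => f x + g x) h := by
  have hspec : spec (fun x => (1 - t) * f0 x + t * f x + ((1 - t) * g0 x + t * g x)) =
      ENNReal.ofReal (1 - t) • spec (fun x => f0 x + g0 x) +
        ENNReal.ofReal t • spec (fun x => f x + g x) := by
    rw [← spec_convex (hf0.add hg0) (hf.add hg) ht0.le ht1.le]
    congr 1; ext x; ring
  have key : ∀ (r : ℝ) (ν ν' : Measure ℝ), 0 < r → ENNReal.ofReal r • ν ≤ ν' →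
      ν ≤ (ENNReal.ofReal r)⁻¹ • ν' := by
    intro r ν ν' hr hle
    have h1 : ν = (ENNReal.ofReal r)⁻¹ • ENNReal.ofReal r • ν := by
      rw [smul_smul, ENNReal.inv_mul_cancel (by simpa using hr) ENNReal.ofReal_ne_top, one_smul]
    rw [h1]
    refine Measure.le_iff.2 fun S hS => ?_
    simp only [Measure.smul_apply, smul_eq_mul]
    exact mul_le_mul_right (Measure.le_iff.1 hle S hS) _
  constructor
  · refine InClosedSpan.mono (c := (ENNReal.ofReal (1 - t))⁻¹) ?_ ?_ hh
    · simpa using ht1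
    · exact key _ _ _ (by linarith) (by rw [hspec]; exact Measure.le_add_right le_rfl)
  · refine InClosedSpan.mono (c := (ENNReal.ofReal t)⁻¹) ?_ ?_ hh
    · simpa using ht0
    · exact key _ _ _ ht0 (by rw [hspec]; exact Measure.le_add_left le_rfl)

/-- If the optimal error does not increase from `(f0, g0)` in the direction of `(f, g)`, then the
optimal characteristic of `(f0, g0)` has no larger error for `(f, g)`. -/
theorem mse_le_of_optimal_convex_le (ha : Summable fun k => ‖a k‖)
    (hf0 : IsSpectralDensity f0) (hg0 : IsSpectralDensity g0) (hf : IsSpectralDensity f)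
    (hg : IsSpectralDensity g) (hm : Minimality f0 g0) (hh : IsProjection a f0 g0 h)
    (hopt : ∀ t : ℝ, 0 < t → t < 1 → ∃ ht,
      MemPast (fun x => (1 - t) * f0 x + t * f x + ((1 - t) * g0 x + t * g x)) ht ∧
      mse a ht (fun x => (1 - t) * f0 x + t * f x) (fun x => (1 - t) * g0 x + t * g x) ≤
        mse a h f0 g0) :
    mse a h f g ≤ mse a h f0 g0 := by
  have hΔ := mse_ne_top ha hf0 hg0 hh.1.1
  set Δ := mse a h f0 g0 with hΔdef
  have hstep : ∀ t : ℝ, 0 < t → t < 1 → ∃ ht, MemPast (fun x => f0 x + g0 x) ht ∧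
      MemPast (fun x => f x + g x) ht ∧ mse a ht f g ≤ Δ ∧
      ENNReal.ofReal (1 - t) * eLpNorm (fun x => h x - ht x) 2 (spec fun x => f0 x + g0 x) ^ 2 ≤
        ENNReal.ofReal t * Δ := by
    intro t ht0 ht1
    obtain ⟨k, hk, hle⟩ := hopt t ht0 ht1
    obtain ⟨hk0, hk1⟩ := hk.of_convex hf0 hg0 hf hg ht0 ht1
    rw [mse_convex a k hf0 hg0 hf hg ht0.le ht1.le, hh.mse_eq_add ha hf0 hg0 hk0, ← hΔdef, mul_add,
      add_assoc] at hle
    have hsplit : Δ = ENNReal.ofReal (1 - t) * Δ + ENNReal.ofReal t * Δ := by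
      rw [← add_mul, ← ENNReal.ofReal_add (by linarith) ht0.le]
      simp
    -- After cancelling the finite term (1-t)Δ, two nonnegative quantities with sum at most tΔ
    -- remain: (1-t)‖h - k‖² and tΔ(k; f, g).
    have hle2 := (ENNReal.add_le_add_iff_left (ENNReal.mul_ne_top ENNReal.ofReal_ne_top hΔ)).1
      (hle.trans_eq hsplit)
    refine ⟨k, hk0, hk1, ?_, le_self_add.trans hle2⟩
    have h3 := le_add_self.trans hle2
    exact (ENNReal.mul_le_mul_iff_right (by simpa using ht0) ENNReal.ofReal_ne_top).1 h3
  -- The choice t = 1/(n+2) keeps 1 - t ≥ 1/2, which costs the constant 2 in the bound ‖h - k‖² ≤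
  -- 2tΔ.
  have ht : ∀ n : ℕ, 0 < (1 : ℝ) / (n + 2) ∧ (1 : ℝ) / (n + 2) ≤ 1 / 2 := fun n =>
    ⟨by positivity, one_div_le_one_div_of_le (by norm_num) (by linarith [n.cast_nonneg (α := ℝ)])⟩
  choose k hk0 hk1 hkm hkd using fun n : ℕ => hstep (1 / (n + 2)) (ht n).1
    (by linarith [(ht n).2])
  have hd2 : Tendsto (fun n => eLpNorm (fun x => h x - k n x) 2 (spec fun x => f0 x + g0 x) ^ 2)
      atTop (𝓝 0) := by
    have h1 : Tendsto (fun n : ℕ => (1 : ℝ) / (n + 2)) atTop (𝓝 0) := by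
      have := (tendsto_add_atTop_iff_nat 2).2 (tendsto_const_div_atTop_nhds_zero_nat (1 : ℝ))
      simpa using this
    have h2 := ENNReal.Tendsto.const_mul (a := 2)
      (ENNReal.Tendsto.mul_const (b := Δ) (ENNReal.tendsto_ofReal h1) (Or.inr hΔ))
      (Or.inr (by norm_num))
    rw [ENNReal.ofReal_zero, zero_mul, mul_zero] at h2
    refine tendsto_of_tendsto_of_tendsto_of_le_of_le tendsto_const_nhds h2 (fun _ => zero_le)
      fun n => ?_
    have h3 : (1 : ℝ≥0∞) ≤ 2 * ENNReal.ofReal (1 - 1 / (n + 2)) := by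
      rw [← ENNReal.ofReal_ofNat, ← ENNReal.ofReal_mul (by norm_num), ← ENNReal.ofReal_one]
      exact ENNReal.ofReal_le_ofReal (by linarith [(ht n).2])
    calc _ = 1 * eLpNorm (fun x => h x - k n x) 2 (spec fun x => f0 x + g0 x) ^ 2 :=
          (one_mul _).symm
      _ ≤ 2 * ENNReal.ofReal (1 - 1 / (n + 2)) *
          eLpNorm (fun x => h x - k n x) 2 (spec fun x => f0 x + g0 x) ^ 2 :=
          mul_le_mul_left h3 _
      _ ≤ _ := by
          rw [mul_assoc]
          exact mul_le_mul_right (hkd n) _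
  have hd : Tendsto (fun n => eLpNorm (k n - h) 2 (spec fun x => f0 x + g0 x)) atTop (𝓝 0) := by
    have h1 := ((ENNReal.continuous_rpow_const (y := 1 / 2)).tendsto 0).comp hd2
    rw [ENNReal.zero_rpow_of_pos (by norm_num)] at h1
    refine h1.congr fun n => ?_
    rw [Function.comp_apply, ← ENNReal.rpow_natCast, ← ENNReal.rpow_mul, eLpNorm_sub_comm]
    norm_num
    rfl
  obtain ⟨ns, -, hns⟩ := (tendstoInMeasure_of_tendsto_eLpNorm two_ne_zero
    (fun n => (hk0 n).1.1) hh.1.1.1 hd).exists_seq_tendsto_ae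
  -- Since f0 + g0 > 0 a.e., null sets of its spectral measure are Lebesgue null, so the a.e.
  -- convergence also holds for `spec` of f + g.
  have hac : spec (fun x => f x + g x) ≪ spec (fun x => f0 x + g0 x) :=
    (spec_absolutelyContinuous _).trans (absolutelyContinuous_spec (hf0.add hg0) hm.1)
  have hX := (memLp_twoSidedChar ha hf hg).1
  have hbound : ∀ n, eLpNorm (fun x => twoSidedChar a f g x - k n x) 2
      (spec fun x => f x + g x) ^ 2 + twoSidedErr a f g ≤ Δ := by
    intro n
    rw [← mse_eq ha hf hg (hk1 n).1.1]
    exact hkm n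
  have hlim : eLpNorm (fun x => twoSidedChar a f g x - h x) 2 (spec fun x => f x + g x) ≤
      (Δ - twoSidedErr a f g) ^ (2 : ℝ)⁻¹ := by
    -- Fatou's lemma: k need not converge in L₂(f+g), but the uniform error bound passes to the a.e.
    -- limit.
    refine Lp.eLpNorm_le_of_ae_tendsto (u := atTop)
      (f := fun i x => twoSidedChar a f g x - k (ns i) x) (Eventually.of_forall fun i => ?_)
      (fun i => hX.sub (hk1 _).1.1) ?_
    · rw [ENNReal.le_rpow_inv_iff two_pos, ENNReal.rpow_two]
      exact ENNReal.le_sub_of_add_le_right (by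
        rw [twoSidedErr_eq ha hf hg]; exact ENNReal.ofReal_ne_top) (hbound (ns i))
    · filter_upwards [hac.ae_le hns] with x hx
      exact tendsto_const_nhds.sub hx
  rw [mse_eq ha hf hg (hh.1.1.1.mono_ac hac)]
  calc _ ≤ ((Δ - twoSidedErr a f g) ^ (2 : ℝ)⁻¹) ^ 2 + twoSidedErr a f g :=
        add_le_add_left (pow_le_pow_left' hlim 2) _
    _ = Δ - twoSidedErr a f g + twoSidedErr a f g := by
        rw [← ENNReal.rpow_natCast, ← ENNReal.rpow_mul]
        norm_num
    _ = Δ := tsub_add_cancel_of_le (le_add_self.trans (hbound 0))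

/-- The pair q itself may violate minimality and so be absent from the maximum problem; the mixtures
with t < 1 are admissible there, and their objective is their optimal error. -/
theorem SolvesMaxProblem.mse_le {D : Set ((ℝ → ℝ) × (ℝ → ℝ))} {c0 : ℕ → ℂ} {C0 : ℝ → ℂ}
    (ha : Summable fun k => ‖a k‖)
    (hD : ∀ q ∈ D, IsSpectralDensity q.1 ∧ IsSpectralDensity q.2)
    (hconv : ∀ q ∈ D, ∀ r ∈ D, ∀ t : ℝ, 0 < t → t < 1 →
      ((fun x => (1 - t) * q.1 x + t * r.1 x, fun x => (1 - t) * q.2 x + t * r.2 x) :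
        (ℝ → ℝ) × (ℝ → ℝ)) ∈ D)
    (hmax : SolvesMaxProblem a D f0 g0 c0) (hm : Minimality f0 g0)
    (hC0 : IsPInvRa a f0 g0 c0 C0) (hp : IsProjection a f0 g0 (charH a f0 g0 C0))
    {q : (ℝ → ℝ) × (ℝ → ℝ)} (hq : q ∈ D) :
    mse a (charH a f0 g0 C0) q.1 q.2 ≤ mse a (charH a f0 g0 C0) f0 g0 := by
  obtain ⟨hmem, v0, hv0, hle⟩ := hmax
  obtain ⟨hf0, hg0⟩ := hD _ hmem
  obtain ⟨hf, hg⟩ := hD _ hq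
  refine mse_le_of_optimal_convex_le ha hf0 hg0 hf hg hm hp fun t ht0 ht1 => ?_
  have hft := hf0.convex hf ht0.le ht1.le
  have hgt := hg0.convex hg ht0.le ht1.le
  have hmt := Minimality.convex hf0 hg0 hf hg hm ht0.le ht1
  obtain ⟨c, C, hC, hproj⟩ := exists_isPInvRa ha hft hgt hmt
  refine ⟨_, hproj.1, ?_⟩
  have h1 := hle _ (hconv _ hmem _ hq t ht0 ht1) hmt c C _ hC (hC.hasObjective ha hft hgt hmt hproj)
  rw [hv0.unique (hC0.hasObjective ha hf0 hg0 hm hp)] at h1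
  exact (ENNReal.toReal_le_toReal (mse_ne_top ha hft hgt hproj.1.1)
    (mse_ne_top ha hf0 hg0 hp.1.1)).1 h1

end SaddlePoint

section Estimates

/-! ### Gram matrices -/

section Gram

variable {α β : Type*} [MeasurableSpace α] [MeasurableSpace β] {ν : Measure α} {ρ : Measure β}
  {e e' : ℕ → α → ℂ} {d : ℕ → β → ℂ}

theorem integral_lincomb_mul_conj_lincomb (he : ∀ k, MemLp (e k) 2 ν)
    (he' : ∀ k, MemLp (e' k) 2 ν) (b c : ℕ →₀ ℂ) :
    ∫ x, lincomb e b x * conj (lincomb e' c x) ∂ν = ∑ l ∈ c.support, conj (c l) *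
      ∑ k ∈ b.support, b k * ∫ x, e k x * conj (e' l x) ∂ν := by
  rw [integral_mul_conj_lincomb he' (memLp_lincomb he b)]
  refine Finset.sum_congr rfl fun l _ => ?_
  congr 1
  simp_rw [← integral_const_mul]
  rw [← integral_finsetSum _ fun k _ => (integrable_mul_conj (he k) (he' l)).const_mul _]
  refine integral_congr_ae (Eventually.of_forall fun x => ?_)
  simp only [lincomb, Finset.sum_mul, mul_assoc]

/-- The norm of a finite combination depends only on the Gram matrix. This carries norms between
random variables and exponentials. -/
theorem eLpNorm_lincomb_eq_of_gram (he : ∀ k, MemLp (e k) 2 ν) (hd : ∀ k, MemLp (d k) 2 ρ)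
    (hgram : ∀ k l, ∫ x, e k x * conj (e l x) ∂ν = ∫ x, d k x * conj (d l x) ∂ρ) (b : ℕ →₀ ℂ) :
    eLpNorm (lincomb e b) 2 ν = eLpNorm (lincomb d b) 2 ρ := by
  have h1 := integral_lincomb_mul_conj_lincomb he he b
  have h2 := integral_lincomb_mul_conj_lincomb hd hd b
  have h := (h1 b).trans (Eq.trans (by simp_rw [hgram]) (h2 b).symm)
  rw [integral_mul_conj_self (memLp_lincomb he b), integral_mul_conj_self (memLp_lincomb hd b),
    Complex.ofReal_inj, ENNReal.toReal_eq_toReal_iff' (by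
      exact ENNReal.pow_ne_top (memLp_lincomb he b).eLpNorm_ne_top)
      (by exact ENNReal.pow_ne_top (memLp_lincomb hd b).eLpNorm_ne_top)] at h
  exact (ENNReal.pow_right_strictMono two_ne_zero).injective h

end Gram

/-! ### Estimates of stationary sequences -/

theorem obsComb_eq {Ω : Type*} (ξ η : ℤ → Ω → ℂ) (b : ℕ →₀ ℂ) (ω : Ω) :
    obsComb ξ η b ω = lincomb (fun k : ℕ => ξ (-(k : ℤ))) b ω +
      lincomb (fun k : ℕ => η (-(k : ℤ))) b ω := by
  simp only [obsComb, lincomb, mul_add, Finset.sum_add_distrib]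

variable {a : ℕ → ℂ} {f g : ℝ → ℝ} {h : ℝ → ℂ} {Ω : Type*} [MeasurableSpace Ω] {μ : Measure Ω}
  {ξ η : ℤ → Ω → ℂ} {X Y : Ω → ℂ}

theorem memPast_pastPoly {s : ℝ → ℝ} (hs : IsSpectralDensity s) (b : ℕ →₀ ℂ) :
    MemPast s (pastPoly b) := by
  have := hs.isFiniteMeasure
  exact ⟨memLp_lincomb (fun k : ℕ => memLp_expo (-(k : ℤ))) b, fun δ hδ => ⟨b, by simpa using hδ⟩⟩

theorem eLpNorm_lincomb_stationary {ζ : ℤ → Ω → ℂ} (hζ : ∀ m, MemLp (ζ m) 2 μ)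
    (hf : IsSpectralDensity f) (hcov : ∀ m n, ∫ ω, ζ m ω * conj (ζ n ω) ∂μ =
      ∫ x, expo (m - n) x * (f x : ℂ) ∂circ) (b : ℕ →₀ ℂ) :
    eLpNorm (lincomb (fun k : ℕ => ζ (-(k : ℤ))) b) 2 μ = eLpNorm (pastPoly b) 2 (spec f) := by
  have := hf.isFiniteMeasure
  refine eLpNorm_lincomb_eq_of_gram (d := fun k : ℕ => expo (-(k : ℤ))) (fun k => hζ _)
    (fun k => memLp_expo _) (fun k l => ?_) b
  rw [hcov, integral_spec hf]
  congr 1; ext x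
  rw [conj_expo, expo_mul, ← sub_eq_add_neg, mul_comm]

namespace IsSignalNoise

/-- Zero correlation makes the signal and noise parts orthogonal. Separate coefficient vectors are
allowed because in the estimation error the functional enters only the signal part. -/
theorem eLpNorm_sq_add (hs : IsSignalNoise μ ξ η f g) (hf : IsSpectralDensity f)
    (hg : IsSpectralDensity g) (b c : ℕ →₀ ℂ) :
    eLpNorm (fun ω => lincomb (fun k : ℕ => ξ (-(k : ℤ))) b ω +
        lincomb (fun k : ℕ => η (-(k : ℤ))) c ω) 2 μ ^ 2 =
      eLpNorm (pastPoly b) 2 (spec f) ^ 2 + eLpNorm (pastPoly c) 2 (spec g) ^ 2 := by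
  rw [eLpNorm_add_sq_of_orthogonal (memLp_lincomb (fun k => hs.signal_memLp _) b)
    (memLp_lincomb (fun k => hs.noise_memLp _) c),
    eLpNorm_lincomb_stationary hs.signal_memLp hf hs.signal_cov,
    eLpNorm_lincomb_stationary hs.noise_memLp hg hs.noise_cov]
  rw [integral_lincomb_mul_conj_lincomb (fun k => hs.signal_memLp _) (fun k => hs.noise_memLp _)]
  simp [hs.uncorrelated]

theorem memLp_obs (hs : IsSignalNoise μ ξ η f g) (k : ℕ) :
    MemLp (fun ω => ξ (-(k : ℤ)) ω + η (-(k : ℤ)) ω) 2 μ :=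
  (hs.signal_memLp _).add (hs.noise_memLp _)

theorem memLp_obsComb (hs : IsSignalNoise μ ξ η f g) (b : ℕ →₀ ℂ) :
    MemLp (obsComb ξ η b) 2 μ :=
  memLp_lincomb hs.memLp_obs b

theorem eLpNorm_obsComb_sub (hs : IsSignalNoise μ ξ η f g) (hf : IsSpectralDensity f)
    (hg : IsSpectralDensity g) (b c : ℕ →₀ ℂ) :
    eLpNorm (fun ω => obsComb ξ η b ω - obsComb ξ η c ω) 2 μ =
      eLpNorm (fun x => pastPoly b x - pastPoly c x) 2 (spec fun x => f x + g x) := by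
  have h1 := hs.eLpNorm_sq_add hf hg (b - c) (b - c)
  have h2 : (fun ω => lincomb (fun k : ℕ => ξ (-(k : ℤ))) (b - c) ω +
      lincomb (fun k : ℕ => η (-(k : ℤ))) (b - c) ω) =
      fun ω => obsComb ξ η b ω - obsComb ξ η c ω := by
    ext ω
    rw [obsComb_eq, obsComb_eq, lincomb_sub, lincomb_sub]; ring
  have h3 : pastPoly (b - c) = fun x => pastPoly b x - pastPoly c x := by
    ext x
    exact lincomb_sub (fun k : ℕ => expo (-(k : ℤ))) b c x
  rw [h2, h3, ← lintegral_enorm_sq (spec f), ← lintegral_enorm_sq (spec g),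
    ← lintegral_add_measure, ← spec_add hf hg, lintegral_enorm_sq] at h1
  exact (ENNReal.pow_right_strictMono two_ne_zero).injective h1

theorem tendsto_eLpNorm_symbolA_sub (ha : Summable fun k => ‖a k‖) (hf : IsSpectralDensity f) :
    Tendsto (fun n => eLpNorm (fun x => symbolA a x -
      pastPoly (∑ k ∈ Finset.range n, Finsupp.single k (a k)) x) 2 (spec f)) atTop (𝓝 0) := by
  have := hf.isFiniteMeasure
  have hbound : ∀ n x, ‖symbolA a x - pastPoly (∑ k ∈ Finset.range n, Finsupp.single k (a k)) x‖ ≤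
      ∑' k, ‖a (k + n)‖ := by
    intro n x
    have hsum : Summable fun k : ℕ => a k * expo (-(k : ℤ)) x :=
      Summable.of_norm (by simpa only [norm_mul_expo] using ha)
    have h1 : pastPoly (∑ k ∈ Finset.range n, Finsupp.single k (a k)) x =
        ∑ k ∈ Finset.range n, a k * expo (-(k : ℤ)) x :=
      lincomb_truncation (fun k : ℕ => expo (-(k : ℤ))) a n x
    rw [h1, symbolA, ← hsum.sum_add_tsum_nat_add n, add_sub_cancel_left]
    exact tsum_of_norm_bounded ((summable_nat_add_iff n).2 ha).hasSum
      fun k => (norm_mul_expo _ _ _).le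
  have hlim := ENNReal.Tendsto.const_mul (a := spec f Set.univ ^ ((2 : ℝ≥0∞).toReal⁻¹))
    (ENNReal.tendsto_ofReal (tendsto_sum_nat_add fun k => ‖a k‖))
    (Or.inr (ENNReal.rpow_ne_top_of_nonneg (by simp) (measure_ne_top _ _)))
  rw [ENNReal.ofReal_zero, mul_zero] at hlim
  exact tendsto_of_tendsto_of_tendsto_of_le_of_le tendsto_const_nhds hlim (fun _ => zero_le)
    fun n => eLpNorm_le_of_ae_bound (Eventually.of_forall (hbound n))

/-- With A ξ truncated to n terms, the error has signal coefficients b - a and noise coefficients b,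
and the Gram identity applies; then n → ∞ on both sides. -/
theorem eLpNorm_sub_obsComb (ha : Summable fun k => ‖a k‖) (hs : IsSignalNoise μ ξ η f g)
    (hf : IsSpectralDensity f) (hg : IsSpectralDensity g) (hX : IsFunctional μ a ξ X)
    (b : ℕ →₀ ℂ) :
    eLpNorm (fun ω => X ω - obsComb ξ η b ω) 2 μ ^ 2 = mse a (pastPoly b) f g := by
  have := hf.isFiniteMeasure
  let t : ℕ → ℕ →₀ ℂ := fun n => ∑ k ∈ Finset.range n, Finsupp.single k (a k)
  have hpoly : ∀ (ν : Measure ℝ) [IsFiniteMeasure ν] (c : ℕ →₀ ℂ), MemLp (pastPoly c) 2 ν :=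
    fun ν _ c => memLp_lincomb (fun k : ℕ => memLp_expo (-(k : ℤ))) c
  have hXt : ∀ n ω, lincomb (fun k : ℕ => ξ (-(k : ℤ))) (t n) ω =
      ∑ k ∈ Finset.range n, a k * ξ (-(k : ℤ)) ω := fun n ω => lincomb_truncation _ a n ω
  have hleft := tendsto_eLpNorm_sub_of_tendsto (X := obsComb ξ η b) (hs.memLp_obsComb b).1 hX.1
    (Yn := fun n => lincomb (fun k : ℕ => ξ (-(k : ℤ))) (t n))
    (fun n => (memLp_lincomb (fun k => hs.signal_memLp _) _).1) (by
      simp_rw [hXt]; exact hX.2)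
  have hA : MemLp (symbolA a) 2 (spec f) := MemLp.of_bound
    (continuous_symbolA ha).aestronglyMeasurable _ (Eventually.of_forall (norm_symbolA_le ha))
  have hright := tendsto_eLpNorm_sub_of_tendsto (X := pastPoly b) (hpoly (spec f) b).1 hA
    (Yn := fun n => pastPoly (t n)) (fun n => (hpoly (spec f) _).1)
    (tendsto_eLpNorm_symbolA_sub ha hf)
  have heq : ∀ n, eLpNorm (fun ω => obsComb ξ η b ω -
      lincomb (fun k : ℕ => ξ (-(k : ℤ))) (t n) ω) 2 μ ^ 2 =
      eLpNorm (fun x => pastPoly b x - pastPoly (t n) x) 2 (spec f) ^ 2 +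
        eLpNorm (pastPoly b) 2 (spec g) ^ 2 := by
    intro n
    have h1 := hs.eLpNorm_sq_add hf hg (b - t n) b
    have h3 : pastPoly (b - t n) = fun x => pastPoly b x - pastPoly (t n) x := by
      ext x
      exact lincomb_sub (fun k : ℕ => expo (-(k : ℤ))) b (t n) x
    rw [h3] at h1
    rw [← h1]
    congr 2
    ext ω
    rw [obsComb_eq, lincomb_sub]; ring
  have hleft2 := ((ENNReal.continuous_pow 2).tendsto _).comp hleft
  have hright2 := (((ENNReal.continuous_pow 2).tendsto _).comp hright).add
    (tendsto_const_nhds (x := eLpNorm (pastPoly b) 2 (spec g) ^ 2))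
  have hfin := tendsto_nhds_unique hleft2 (hright2.congr fun n => (heq n).symm)
  have c1 : eLpNorm (fun ω => X ω - obsComb ξ η b ω) 2 μ =
      eLpNorm (fun ω => obsComb ξ η b ω - X ω) 2 μ := eLpNorm_sub_comm _ _ _ _
  have c2 : eLpNorm (fun x => symbolA a x - pastPoly b x) 2 (spec f) =
      eLpNorm (fun x => pastPoly b x - symbolA a x) 2 (spec f) := eLpNorm_sub_comm _ _ _ _
  rw [c1, hfin, mse, lintegral_enorm_sq (spec f) (fun x => symbolA a x - pastPoly b x),
    lintegral_enorm_sq, c2]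

/-- Y is a limit of finite combinations, and the error of each is `mse` of an admissible polynomial
characteristic. -/
theorem optErr_le (ha : Summable fun k => ‖a k‖) (hs : IsSignalNoise μ ξ η f g)
    (hf : IsSpectralDensity f) (hg : IsSpectralDensity g) (hX : IsFunctional μ a ξ X)
    (hY : Y ∈ obsSpace μ ξ η) : optErr a f g ≤ ∫⁻ ω, ‖X ω - Y ω‖ₑ ^ 2 ∂μ := by
  have hY' : InClosedSpan μ (fun (k : ℕ) ω => ξ (-(k : ℤ)) ω + η (-(k : ℤ)) ω) Y := hY
  obtain ⟨b, hb⟩ := hY'.exists_tendsto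
  have h1 := ((ENNReal.continuous_pow 2).tendsto _).comp
    (tendsto_eLpNorm_sub_of_tendsto hX.1.1 hY.1 (fun n => (hs.memLp_obsComb (b n)).1) hb)
  rw [lintegral_enorm_sq μ (fun ω => X ω - Y ω)]
  refine ge_of_tendsto' h1 fun n => ?_
  rw [Function.comp_apply, hs.eLpNorm_sub_obsComb ha hf hg hX]
  exact iInf₂_le _ (memPast_pastPoly (hf.add hg) (b n))

/-- The estimate with a given spectral characteristic exists, and its mean-square error is `mse`. -/
theorem exists_estimate (ha : Summable fun k => ‖a k‖) (hs : IsSignalNoise μ ξ η f g)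
    (hf : IsSpectralDensity f) (hg : IsSpectralDensity g) (hX : IsFunctional μ a ξ X)
    (hh : MemPast (fun x => f x + g x) h) : ∃ Y ∈ obsSpace μ ξ η,
      HasSpectralChar μ ξ η (fun x => f x + g x) h Y ∧
        ∫⁻ ω, ‖X ω - Y ω‖ₑ ^ 2 ∂μ = mse a h f g := by
  have hfin := (hf.add hg).isFiniteMeasure
  have hh' : InClosedSpan (spec fun x => f x + g x) (fun k : ℕ => expo (-(k : ℤ))) h := hh
  have hpoly : ∀ c : ℕ →₀ ℂ, MemLp (pastPoly c) 2 (spec fun x => f x + g x) :=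
    fun c => memLp_lincomb (fun k : ℕ => memLp_expo (-(k : ℤ))) c
  -- Geometric tolerances make the images summably Cauchy, as the completeness lemma requires;
  -- comparing two polynomials through h gives the factor 2 below.
  obtain ⟨b, hb⟩ := hh'.exists_seq (B := fun n => (2⁻¹ : ℝ≥0∞) ^ n)
    (fun n => ENNReal.pow_pos (by simp) n)
  change ∀ n, eLpNorm (fun x => h x - pastPoly (b n) x) 2 _ < _ at hb
  have hb0 : Tendsto (fun n => eLpNorm (fun x => h x - pastPoly (b n) x) 2
      (spec fun x => f x + g x)) atTop (𝓝 0) :=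
    tendsto_of_tendsto_of_tendsto_of_le_of_le tendsto_const_nhds
      (ENNReal.tendsto_pow_atTop_nhds_zero_of_lt_one (by norm_num)) (fun _ => zero_le)
      fun n => (hb n).le
  obtain ⟨Y, hY, hYlim⟩ := Lp.cauchy_complete_eLpNorm (p := 2) (by norm_num)
    (f := fun n => obsComb ξ η (b n)) (fun n => hs.memLp_obsComb (b n))
    (B := fun n => (2⁻¹ : ℝ≥0∞) ^ n * 2)
    (by rw [ENNReal.tsum_mul_right, ENNReal.tsum_geometric]; norm_num) (fun N n m hn hm => by
      change eLpNorm (fun ω => obsComb ξ η (b n) ω - obsComb ξ η (b m) ω) 2 μ < _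
      rw [hs.eLpNorm_obsComb_sub hf hg]
      have hle : ∀ k, N ≤ k → eLpNorm (fun x => h x - pastPoly (b k) x) 2
          (spec fun x => f x + g x) < 2⁻¹ ^ N := fun k hk =>
        (hb k).trans_le (pow_le_pow_right_of_le_one' (by norm_num) hk)
      have htri := eLpNorm_sub_le (p := 2) ((hh.1.sub (hpoly (b m))).1)
        ((hh.1.sub (hpoly (b n))).1) (by norm_num)
      rw [sub_sub_sub_cancel_left] at htri
      refine htri.trans_lt ?_
      rw [mul_two]
      exact ENNReal.add_lt_add (hle m hm) (hle n hn))
  have hYlim' : Tendsto (fun n => eLpNorm (fun ω => Y ω - obsComb ξ η (b n) ω) 2 μ) atTop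
      (𝓝 0) := hYlim.congr fun n => eLpNorm_sub_comm _ _ _ _
  refine ⟨Y, inClosedSpan_of_tendsto hY hYlim', ⟨hY, hh.1, b, hb0, hYlim'⟩, ?_⟩
  have h1 := ((ENNReal.continuous_pow 2).tendsto _).comp
    (tendsto_eLpNorm_sub_of_tendsto hX.1.1 hY (fun n => (hs.memLp_obsComb (b n)).1) hYlim')
  have h2 := (((ENNReal.continuous_pow 2).tendsto _).comp
    (tendsto_eLpNorm_sub_of_tendsto (memLp_twoSidedChar ha hf hg).1 hh.1
      (fun n => (hpoly (b n)).1) hb0)).add (tendsto_const_nhds (x := twoSidedErr a f g))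
  rw [lintegral_enorm_sq μ (fun ω => X ω - Y ω), mse_eq ha hf hg hh.1.1]
  refine tendsto_nhds_unique h1 (h2.congr fun n => ?_)
  rw [Function.comp_apply, Function.comp_apply, hs.eLpNorm_sub_obsComb ha hf hg hX,
    mse_eq ha hf hg (hpoly (b n)).1]

end IsSignalNoise

end Estimates

end RobustFilter

end

/-! ### The minimax theorem -/

/-- The optimal error is concave in the pair of densities, and the objective of the maximum problem
is its value at every pair with the minimality condition, so that maximality of `(f0, g0)` yields the
saddle point inequality directly. The multiplier equations are not needed for this direction. -/
theorem mainTheorem9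
    (a : ℕ → ℂ) (ha1 : Summable fun k => ‖a k‖)
    (ha2 : Summable fun k : ℕ => ((k : ℝ) + 1) * ‖a k‖ ^ 2)
    -- the data of the classes
    (u v g1 : ℝ → ℝ) (ε P1 P2 : ℝ)
    (hu : RobustFilter.IsSpectralDensity u) (hv : RobustFilter.IsSpectralDensity v)
    (hg1 : RobustFilter.IsSpectralDensity g1)
    (hu_bdd : ∃ K : ℝ, ∀ᵐ x ∂(RobustFilter.circ), u x ≤ K)
    (hv_bdd : ∃ K : ℝ, ∀ᵐ x ∂(RobustFilter.circ), v x ≤ K)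
    (hε0 : 0 ≤ ε) (hε1 : ε ≤ 1)
    -- the pair of densities
    (f0 g0 : ℝ → ℝ)
    (hf0 : f0 ∈ RobustFilter.bandClass v u P1)
    (hg0 : g0 ∈ RobustFilter.contamClass ε g1 P2)
    (hmin : RobustFilter.Minimality f0 g0)
    -- the vector obtained from the inverse operator, and the sum of its series
    (c0 : ℕ → ℂ) (C0 : ℝ → ℂ) (hC0 : RobustFilter.IsPInvRa a f0 g0 c0 C0)
    (hhf : ∃ K : ℝ, ∀ᵐ x ∂(RobustFilter.circ), RobustFilter.hf a f0 g0 C0 x ≤ K)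
    (hhg : ∃ K : ℝ, ∀ᵐ x ∂(RobustFilter.circ), RobustFilter.hg a f0 g0 C0 x ≤ K)
    -- the multipliers and the equations
    (γ1 γ2 φ : ℝ → ℝ) (α1 α2 : ℝ) (hα1 : α1 ≠ 0) (hα2 : α2 ≠ 0)
    (hγ1 : ∀ᵐ x ∂(RobustFilter.circ), γ1 x ≤ 0 ∧ (v x < f0 x → γ1 x = 0))
    (hγ2 : ∀ᵐ x ∂(RobustFilter.circ), 0 ≤ γ2 x ∧ (f0 x < u x → γ2 x = 0))
    (hφ : ∀ᵐ x ∂(RobustFilter.circ), φ x ≤ 0 ∧ ((1 - ε) * g1 x < g0 x → φ x = 0))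
    (heq1 : ∀ᵐ x ∂(RobustFilter.circ),
      ‖RobustFilter.symbolA a x * (g0 x : ℂ) + C0 x‖ = (f0 x + g0 x) * (γ1 x + γ2 x + α1⁻¹))
    (heq2 : ∀ᵐ x ∂(RobustFilter.circ),
      ‖RobustFilter.symbolA a x * (f0 x : ℂ) - C0 x‖ = (f0 x + g0 x) * (φ x + α2⁻¹))
    -- the optimization problem
    (hmax : RobustFilter.SolvesMaxProblem a
      (RobustFilter.bandClass v u P1 ×ˢ RobustFilter.contamClass ε g1 P2) f0 g0 c0) :
    RobustFilter.LeastFavorable a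
        (RobustFilter.bandClass v u P1 ×ˢ RobustFilter.contamClass ε g1 P2) f0 g0 ∧
      RobustFilter.IsOptimalChar a f0 g0 (RobustFilter.charH a f0 g0 C0) ∧
      RobustFilter.MinimaxRobust a
        (RobustFilter.bandClass v u P1 ×ˢ RobustFilter.contamClass ε g1 P2)
        (RobustFilter.charH a f0 g0 C0) ∧
      -- the meaning of the errors for stationary sequences with admissible densities
      ∀ f ∈ RobustFilter.bandClass v u P1, ∀ g ∈ RobustFilter.contamClass ε g1 P2,
        ∀ (Ω : Type*) [MeasurableSpace Ω] (μ : MeasureTheory.Measure Ω)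
          [MeasureTheory.IsProbabilityMeasure μ] (ξ η : ℤ → Ω → ℂ) (X : Ω → ℂ),
          RobustFilter.IsSignalNoise μ ξ η f g → RobustFilter.IsFunctional μ a ξ X →
            IsLeast ((fun Y : Ω → ℂ => ∫⁻ ω, ‖X ω - Y ω‖ₑ ^ 2 ∂μ) ''
                RobustFilter.obsSpace μ ξ η) (RobustFilter.optErr a f g) ∧
              ∃ Y ∈ RobustFilter.obsSpace μ ξ η,
                RobustFilter.HasSpectralChar μ ξ η (fun x => f x + g x)
                    (RobustFilter.charH a f0 g0 C0) Y ∧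
                  ∫⁻ ω, ‖X ω - Y ω‖ₑ ^ 2 ∂μ =
                    RobustFilter.mse a (RobustFilter.charH a f0 g0 C0) f g := by
  obtain ⟨K, hK⟩ := hhg
  have hD : ∀ q ∈ RobustFilter.bandClass v u P1 ×ˢ RobustFilter.contamClass ε g1 P2,
      RobustFilter.IsSpectralDensity q.1 ∧ RobustFilter.IsSpectralDensity q.2 :=
    fun q hq => ⟨hq.1.1, hq.2.1⟩
  have hpast : ∀ s, RobustFilter.IsSpectralDensity s →
      RobustFilter.MemPast s (RobustFilter.charH a f0 g0 C0) :=
    fun s hs => hC0.memPast_charH ha1 hf0.1 hg0.1 hmin hK hs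
  have hproj := hC0.isProjection hf0.1 hg0.1 hmin (hpast _ (hf0.1.add hg0.1))
  have hopt := hproj.isOptimalChar ha1 hf0.1 hg0.1
  have hmem : (f0, g0) ∈ RobustFilter.bandClass v u P1 ×ˢ RobustFilter.contamClass ε g1 P2 :=
    ⟨hf0, hg0⟩
  have hsaddle : ∀ q ∈ RobustFilter.bandClass v u P1 ×ˢ RobustFilter.contamClass ε g1 P2,
      RobustFilter.mse a (RobustFilter.charH a f0 g0 C0) q.1 q.2 ≤
        RobustFilter.mse a (RobustFilter.charH a f0 g0 C0) f0 g0 := fun q hq =>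
    hmax.mse_le ha1 hD (fun q hq r hr t ht0 ht1 =>
      ⟨RobustFilter.bandClass_convex hq.1 hr.1 ht0.le ht1.le,
        RobustFilter.contamClass_convex hq.2 hr.2 ht0.le ht1.le⟩) hmin hC0 hproj hq
  have hrobust : RobustFilter.charH a f0 g0 C0 ∈ RobustFilter.robustSpace
      (RobustFilter.bandClass v u P1 ×ˢ RobustFilter.contamClass ε g1 P2) :=
    fun q hq => hpast _ ((hD q hq).1.add (hD q hq).2)
  refine ⟨⟨hmem, ⟨(f0, g0), hmem, rfl⟩, ?_⟩, hopt, ⟨hrobust, ⟨_, hrobust, rfl⟩, ?_⟩, ?_⟩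
  · rintro _ ⟨q, hq, rfl⟩
    -- Δ(f, g) ≤ Δ(h⁰; f, g) ≤ Δ(h⁰; f⁰, g⁰), because h⁰ is admissible for every pair in D.
    rw [← hopt.2]
    exact (iInf₂_le _ (hrobust q hq)).trans (hsaddle q hq)
  · rintro _ ⟨h, hh, rfl⟩
    -- The worst error of h⁰ is at most Δ(f⁰, g⁰), which bounds from below the error of any
    -- competitor at (f⁰, g⁰), hence its worst error.
    refine (iSup₂_le hsaddle).trans ?_
    rw [hopt.2]
    exact (iInf₂_le h (hh _ hmem)).trans
      (le_iSup₂ (f := fun q (_ : q ∈ RobustFilter.bandClass v u P1 ×ˢ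
        RobustFilter.contamClass ε g1 P2) => RobustFilter.mse a h q.1 q.2) (f0, g0) hmem)
  · intro f hf g hg Ω _ μ _ ξ η X hs hX
    -- The projection exists without minimality, so the minimum is attained for every admissible
    -- pair.
    obtain ⟨h, hh⟩ := RobustFilter.exists_isProjection ha1 hf.1 hg.1
    obtain ⟨Y, hY, -, hYerr⟩ := hs.exists_estimate ha1 hf.1 hg.1 hX hh.1
    refine ⟨⟨⟨Y, hY, ?_⟩, ?_⟩, hs.exists_estimate ha1 hf.1 hg.1 hX (hpast _ (hf.1.add hg.1))⟩
    · exact hYerr.trans (hh.isOptimalChar ha1 hf.1 hg.1).2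
    · rintro _ ⟨Z, hZ, rfl⟩
      exact hs.optErr_le ha1 hf.1 hg.1 hX hZ
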